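/- Let $X^n$ be one of the $n$-dimensional spaces of constant curvature: the Euclidean space $E^n=\mathbb{R}^n$, the unit sphere $S^n\subset\mathbb{R}^{n+1}$, or the hyperbolic space $H^n=\{x\in\mathbb{R}^{n+1}: -x_0^2+x_1^2+\dots+x_n^2=-1,\ x_0>0\}$. Let $V$ be $\mathbb{R}^n$, $\mathbb{R}^{n+1}$, $\mathbb{R}^{n+1}$, respectively, with the bilinear form $(\cdot,\cdot)$ equal to the standard inner product in the first two cases and to $-x_0y_0+x_1y_1+\dots+x_ny_n$ in the third. A halfspace of $X^n$ is a set $H^-=\{x\in X^n:(e,x)\ge c\}$ with $e\in V$, $(e,e)=1$, $c\in\mathbb{R}$, and $c=0$ unless $X^n=E^n$. Its bounding hyperplane is $H=\{x\in X^n:(e,x)=c\}$, and the reflection in $H$ is $r_H(x)=x-2((e,x)-c)\,e$. For two halfspaces with unit vectors $e_1,e_2$, the angle is called divergent if $X^n=H^n$ and $|(e_1,e_2)|>1$; otherwise it is the number $\varphi\in[0,\pi]$ with $\cos\varphi=-(e_1,e_2)$. A convex polytope is an intersection $P=\bigcap_{i\in I}H_i^-$ of a set of halfspaces such that every compact subset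 of $X^n$ meets only finitely many of the hyperplanes $H_i$, $P$ has non-empty interior, and no $H_i^-$ contains the intersection of the others. A reflection group is a discrete subgroup of the group $\mathrm{Iso}(X^n)$ of isometries of $X^n$ that is generated by reflections. A closed set $P\subset X^n$ is a fundamental domain of a group $\Gamma\subset\mathrm{Iso}(X^n)$ if $\bigcup_{g\in\Gamma}gP=X^n$ and the interiors of $gP$ and $P$ are disjoint for every $g\in\Gamma$, $g\ne1$. **Theorem.** Let $\Gamma$ be a reflection group in $X^n$. There exists a convex polytope $P=\bigcap_{i\in I}H_i^-$ such that (i) $P$ is a fundamental domain for the action of $\Gamma$ on $X^n$; (ii) for any two distinct $i,j\in I$ the angle between $H_i^-$ and $H_j^-$ is equal to $0$ or to $\pi/m_{ij}$ for some positive integer $m_{ij}$, unless it is divergent; (iii) $\Gamma$ is generated by the reflections $r_{H_i}$, $i\in I$. Conversely, for every convex polytope $P=\bigcap_{i\in I}H_i^-$ with property (ii), the group $\Gamma(P)$ generated by the reflections $r_{H_i}$, $i\in I$, is a reflection group, and $P$ is a fundamental domain for the action of $\Gamma(P)$ on $X^n$. -/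

import Mathlib

noncomputable section

namespace ReflectionGroups

/-- The three geometries of constant curvature. -/
inductive Geometry where
  | euclidean
  | spherical
  | hyperbolic

/-- The dimension of the vector space `V` attached to the `n`-dimensional space `Xⁿ`:
`n` for `Eⁿ`, and `n + 1` for `Sⁿ` and `Hⁿ`. -/
abbrev Geometry.ambientDim : Geometry → ℕ → ℕ
  | .euclidean, n => n
  | .spherical, n => n + 1
  | .hyperbolic, n => n + 1

/-- The vector space `V`: `ℝⁿ` for `Eⁿ`, and `ℝⁿ⁺¹` for `Sⁿ` and `Hⁿ`. -/
abbrev Ambient (G : Geometry) (n : ℕ) : Type := EuclideanSpace ℝ (Fin (G.ambientDim n))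

/-- The Lorentzian form `-x₀ y₀ + x₁ y₁ + ⋯ + xₙ yₙ` on `ℝⁿ⁺¹`. -/
def lorentz {n : ℕ} (x y : EuclideanSpace ℝ (Fin (n + 1))) : ℝ :=
  -(x 0 * y 0) + ∑ i : Fin n, x i.succ * y i.succ

/-- The standard symmetric bilinear form on `V`: the Euclidean inner product in the euclidean and
the spherical case, the Lorentzian form of signature `(n, 1)` in the hyperbolic case. -/
def form : {G : Geometry} → {n : ℕ} → Ambient G n → Ambient G n → ℝ
  | .euclidean, _, x, y => inner ℝ x y
  | .spherical, _, x, y => inner ℝ x y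
  | .hyperbolic, _, x, y => lorentz x y

/-- The points of `Xⁿ` as a subset of `V`: all of `ℝⁿ`, the unit sphere of `ℝⁿ⁺¹`, or the upper
sheet of the hyperboloid `-x₀² + x₁² + ⋯ + xₙ² = -1`. -/
def points : (G : Geometry) → (n : ℕ) → Set (Ambient G n)
  | .euclidean, _ => Set.univ
  | .spherical, _ => {x | ‖x‖ = 1}
  | .hyperbolic, _ => {x | lorentz x x = -1 ∧ 0 < x 0}

/-- The space of constant curvature `Xⁿ`, i.e. `Eⁿ`, `Sⁿ` or `Hⁿ`, with the topology induced
from `V` (which is the topology of its Riemannian metric). -/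
abbrev Space (G : Geometry) (n : ℕ) : Type := ↥(points G n)

/-- The geodesic distance of `Xⁿ`. -/
def geodesicDist : {G : Geometry} → {n : ℕ} → Space G n → Space G n → ℝ
  | .euclidean, _, x, y => ‖x.1 - y.1‖
  | .spherical, _, x, y => Real.arccos (inner ℝ x.1 y.1)
  | .hyperbolic, _, x, y => Real.arcosh (-lorentz x.1 y.1)

/-- The group of motions (isometries) of `Xⁿ`, as a subgroup of its homeomorphisms. -/
def isoSubgroup (G : Geometry) (n : ℕ) : Subgroup (Space G n ≃ₜ Space G n) where
  carrier := {g | ∀ x y, geodesicDist (g x) (g y) = geodesicDist x y}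
  one_mem' := fun _ _ => rfl
  mul_mem' := fun {g h} hg hh x y => (hg (h x) (h y)).trans (hh x y)
  inv_mem' := fun {g} hg x y => by
    have h := hg (g⁻¹ x) (g⁻¹ y)
    have e : ∀ z, g (g⁻¹ z) = z := fun z => g.apply_symm_apply z
    rw [e, e] at h
    exact h.symm

/-- The group `Iso(Xⁿ)` of motions of `Xⁿ`. -/
abbrev Iso (G : Geometry) (n : ℕ) : Type := ↥(isoSubgroup G n)

/-- `Iso(Xⁿ)` carries the compact-open topology. -/
instance isoTopology (G : Geometry) (n : ℕ) : TopologicalSpace (Iso G n) :=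
  TopologicalSpace.induced (fun g => (g.1 : C(Space G n, Space G n))) inferInstance

/-- An oriented hyperplane of `Xⁿ`, equivalently a halfspace: a unit vector `e` of `V` and a real
number `c`, with `c = 0` unless `Xⁿ = Eⁿ`. The hyperplane is `{x ∈ Xⁿ | (e, x) = c}`, and the
halfspace is the side of it into which `e` points. -/
structure Halfspace (G : Geometry) (n : ℕ) where
  normal : Ambient G n
  offset : ℝ
  unit : form normal normal = 1
  offset_eq_zero : G ≠ .euclidean → offset = 0

namespace Halfspace

variable {G : Geometry} {n : ℕ}

/-- The bounding hyperplane. -/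
def hyperplane (H : Halfspace G n) : Set (Space G n) := {x | form H.normal x.1 = H.offset}

/-- The closed halfspace itself. -/
def carrier (H : Halfspace G n) : Set (Space G n) := {x | H.offset ≤ form H.normal x.1}

/-- The reflection formula on `V`: with `x = h + v`, where `h` lies on the hyperplane and
`v = ((e, x) - c) e` is orthogonal to it, this is `h - v`. -/
def reflectVec (H : Halfspace G n) (x : Ambient G n) : Ambient G n :=
  x - (2 * (form H.normal x - H.offset)) • H.normal

end Halfspace

theorem lorentz_eq {n : ℕ} (x y : EuclideanSpace ℝ (Fin (n + 1))) :
    lorentz x y = inner ℝ x y - 2 * (x 0 * y 0) := by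
  simp only [lorentz, PiLp.inner_apply, Fin.sum_univ_succ, RCLike.inner_apply, conj_trivial]
  rw [Finset.sum_congr rfl fun (i : Fin n) _ => mul_comm (x i.succ) (y i.succ)]
  ring

theorem form_comm {G : Geometry} {n : ℕ} (x y : Ambient G n) : form x y = form y x := by
  cases G
  · exact real_inner_comm _ _
  · exact real_inner_comm _ _
  · simp only [form, lorentz_eq, real_inner_comm, mul_comm]

theorem form_sub_smul {G : Geometry} {n : ℕ} (x y e : Ambient G n) (t : ℝ) :
    form x (y - t • e) = form x y - t * form x e := by
  cases G
  · simp only [form, inner_sub_right, inner_smul_right]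
  · simp only [form, inner_sub_right, inner_smul_right]
  · simp only [form, lorentz_eq, inner_sub_right, inner_smul_right, PiLp.sub_apply,
      PiLp.smul_apply, smul_eq_mul]
    ring

namespace Halfspace

variable {G : Geometry} {n : ℕ}

theorem form_normal_reflectVec (H : Halfspace G n) (x : Ambient G n) :
    form H.normal (H.reflectVec x) = 2 * H.offset - form H.normal x := by
  rw [reflectVec, form_sub_smul, H.unit]
  ring

theorem reflectVec_reflectVec (H : Halfspace G n) (x : Ambient G n) :
    H.reflectVec (H.reflectVec x) = x := by
  rw [reflectVec, form_normal_reflectVec, reflectVec, sub_sub, ← add_smul]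
  ring_nf
  simp

theorem form_reflectVec (H : Halfspace G n) (h0 : H.offset = 0) (x y : Ambient G n) :
    form (H.reflectVec x) (H.reflectVec y) = form x y := by
  have h1 := form_normal_reflectVec H x
  conv_lhs => rw [reflectVec.eq_1 H y]
  rw [form_sub_smul, form_comm _ H.normal, h1, form_comm _ y, reflectVec, form_sub_smul,
    form_comm y H.normal, form_comm y x, h0]
  ring

end Halfspace

/-- The reversed Cauchy–Schwarz inequality in the form needed for the two sheets. -/
theorem lorentz_pos_of_neg {n : ℕ} (x y : EuclideanSpace ℝ (Fin (n + 1)))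
    (hx : lorentz x x = -1) (hy : lorentz y y = -1) (hx0 : 0 < x 0) (hxy : lorentz x y ≤ 0) :
    0 < y 0 := by
  by_contra hcon
  push Not at hcon
  simp only [lorentz] at hx hy hxy
  have hcs := Finset.sum_mul_sq_le_sq_mul_sq Finset.univ (fun i : Fin n => x i.succ)
    (fun i : Fin n => y i.succ)
  set a := ∑ i : Fin n, x i.succ * y i.succ
  have hA : ∑ i : Fin n, x i.succ ^ 2 = x 0 ^ 2 - 1 := by
    simp only [pow_two]; linarith
  have hB : ∑ i : Fin n, y i.succ ^ 2 = y 0 ^ 2 - 1 := by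
    simp only [pow_two]; linarith
  have hA0 : 0 ≤ x 0 ^ 2 - 1 := hA ▸ Finset.sum_nonneg fun i _ => sq_nonneg _
  have hB0 : 0 ≤ y 0 ^ 2 - 1 := hB ▸ Finset.sum_nonneg fun i _ => sq_nonneg _
  rw [hA, hB] at hcs
  have hp : x 0 * y 0 ≤ 0 := mul_nonpos_of_nonneg_of_nonpos hx0.le hcon
  nlinarith

namespace Halfspace

variable {G : Geometry} {n : ℕ}

theorem reflectVec_mem (H : Halfspace G n) {x : Ambient G n} (hx : x ∈ points G n) :
    H.reflectVec x ∈ points G n := by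
  cases G
  · trivial
  · have h0 := H.offset_eq_zero (by simp)
    have h := H.form_reflectVec h0 x x
    simp only [form, real_inner_self_eq_norm_sq] at h
    change ‖x‖ = 1 at hx
    change ‖H.reflectVec x‖ = 1
    rw [hx] at h
    nlinarith [norm_nonneg (H.reflectVec x)]
  · have h0 := H.offset_eq_zero (by simp)
    have h : lorentz (H.reflectVec x) (H.reflectVec x) = lorentz x x := H.form_reflectVec h0 x x
    refine ⟨h.trans hx.1, lorentz_pos_of_neg x _ hx.1 (h.trans hx.1) hx.2 ?_⟩
    have h2 := form_sub_smul x x H.normal (2 * (form H.normal x - H.offset))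
    rw [form_comm x H.normal, h0] at h2
    have h3 : lorentz x (H.reflectVec x)
        = lorentz x x - 2 * (form H.normal x - 0) * form H.normal x := by
      rw [reflectVec, h0]; exact h2
    rw [h3, hx.1]
    nlinarith [sq_nonneg (form H.normal x)]

theorem continuous_form (e : Ambient G n) : Continuous fun x : Ambient G n => form e x := by
  cases G
  · simp only [form]; fun_prop
  · simp only [form]; fun_prop
  · simp only [form, lorentz]; fun_prop

theorem continuous_reflectVec (H : Halfspace G n) : Continuous H.reflectVec := by
  have := continuous_form H.normal
  unfold reflectVec
  fun_prop

/-- The reflection of `Xⁿ` in the bounding hyperplane, as a homeomorphism. -/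
def reflectHomeo (H : Halfspace G n) : Space G n ≃ₜ Space G n where
  toFun x := ⟨H.reflectVec x.1, H.reflectVec_mem x.2⟩
  invFun x := ⟨H.reflectVec x.1, H.reflectVec_mem x.2⟩
  left_inv x := Subtype.ext (H.reflectVec_reflectVec x.1)
  right_inv x := Subtype.ext (H.reflectVec_reflectVec x.1)
  continuous_toFun := (H.continuous_reflectVec.comp continuous_subtype_val).subtype_mk _
  continuous_invFun := (H.continuous_reflectVec.comp continuous_subtype_val).subtype_mk _

theorem reflectHomeo_mem (H : Halfspace G n) : H.reflectHomeo ∈ isoSubgroup G n := by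
  intro x y
  cases G
  · change ‖H.reflectVec x.1 - H.reflectVec y.1‖ = ‖x.1 - y.1‖
    have hu : inner ℝ H.normal H.normal = (1 : ℝ) := H.unit
    have hd : H.reflectVec x.1 - H.reflectVec y.1
        = (x.1 - y.1) - (2 * inner ℝ H.normal (x.1 - y.1)) • H.normal := by
      simp only [reflectVec, form, inner_sub_right]
      module
    rw [hd, ← sq_eq_sq₀ (norm_nonneg _) (norm_nonneg _), norm_sub_sq_real, norm_smul,
      inner_smul_right, mul_pow, ← real_inner_self_eq_norm_sq H.normal, hu, Real.norm_eq_abs,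
      sq_abs, real_inner_comm]
    ring
  · exact congrArg Real.arccos (H.form_reflectVec (H.offset_eq_zero (by simp)) x.1 y.1)
  · exact congrArg (fun t => Real.arcosh (-t))
      (H.form_reflectVec (H.offset_eq_zero (by simp)) x.1 y.1)

/-- The reflection `r_H` of `Xⁿ` whose mirror is the bounding hyperplane of `H`. -/
def reflection (H : Halfspace G n) : Iso G n := ⟨H.reflectHomeo, H.reflectHomeo_mem⟩

end Halfspace

variable {G : Geometry} {n : ℕ}

/-- A reflection group: a discrete group of motions of `Xⁿ` generated by reflections. -/
def IsReflectionGroup (Γ : Subgroup (Iso G n)) : Prop :=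
  DiscreteTopology Γ ∧
    ∃ S : Set (Halfspace G n), Γ = Subgroup.closure (Halfspace.reflection '' S)

/-- The intersection of a set of halfspaces. -/
def polytope (W : Set (Halfspace G n)) : Set (Space G n) := ⋂ H ∈ W, H.carrier

/-- The set `W` of halfspaces defines a convex polytope: every compact set meets only finitely
many of the bounding hyperplanes, the intersection of the halfspaces has interior points, and none
of the halfspaces contains the intersection of the others. -/
structure IsConvexPolytope (W : Set (Halfspace G n)) : Prop where
  locallyFinite : ∀ K : Set (Space G n), IsCompact K →
    {H ∈ W | (H.hyperplane ∩ K).Nonempty}.Finite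
  interior_nonempty : (interior (polytope W)).Nonempty
  irredundant : ∀ H ∈ W, ¬ polytope (W \ {H}) ⊆ H.carrier

/-- The angle between two halfspaces with unit vectors `e₁`, `e₂` is divergent if `Xⁿ = Hⁿ` and
`|(e₁, e₂)| > 1`, so that `cos φ = -(e₁, e₂)` has no solution. -/
def Divergent (H K : Halfspace G n) : Prop :=
  G = .hyperbolic ∧ 1 < |form H.normal K.normal|

/-- The angle `φ` with `cos φ = -(e₁, e₂)`, `0 ≤ φ ≤ π`, of two halfspaces that are not
divergent. -/
def angle (H K : Halfspace G n) : ℝ := Real.arccos (-form H.normal K.normal)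

/-- The angle between any two of the halfspaces is `0` or `π / m` for a positive integer `m`,
unless it is divergent. -/
def CoxeterAngles (W : Set (Halfspace G n)) : Prop :=
  ∀ H ∈ W, ∀ K ∈ W, H ≠ K → ¬ Divergent H K →
    angle H K = 0 ∨ ∃ m : ℕ, 0 < m ∧ angle H K = Real.pi / m

/-- The closed set `P` is a fundamental domain for the action of `Γ` on `Xⁿ`: every orbit meets
`P`, and the interiors of distinct translates of `P` are disjoint. -/
structure IsFundamentalDomain (Γ : Subgroup (Iso G n)) (P : Set (Space G n)) : Prop where
  isClosed : IsClosed P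
  covers : ∀ x : Space G n, ∃ g ∈ Γ, g.1 x ∈ P
  disjoint : ∀ g ∈ Γ, g ≠ 1 → Disjoint (g.1 '' interior P) (interior P)

/-- The group `Γ(P)` generated by the reflections in the bounding hyperplanes. -/
def reflectionGroupOf (W : Set (Halfspace G n)) : Subgroup (Iso G n) :=
  Subgroup.closure (Halfspace.reflection '' W)

end ReflectionGroups

end

noncomputable section

namespace ReflectionGroups

variable {G : Geometry} {n : ℕ}

/-! All three geometries are handled through the bilinear form: `Halfspace.eval` is the signed
height over a hyperplane, and `sqDist`, the form of a difference of points, replaces the distance.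
Reflecting x in H changes its `sqDist` to y by four times the product of their heights.

Converse half. Irredundancy rules out (e₁,e₂) ≥ 1, so any two distinct walls satisfy (e₁,e₂) ≤ -1 or
(e₁,e₂) = -cos(π/m) with m ≥ 2 (`CoxeterForm`). Tits' lemma (`eval_pos_or_wordLength_lt`) says that
for w in the group and a wall H, either w carries the open chamber to the positive side of H, or r_H
w is shorter than w; its proof reduces to the dihedral group of two walls, where heights are
explicit sines. Hence no g ≠ 1 maps a point of the chamber into the chamber, which gives
disjointness and discreteness. A point of an orbit nearest to a fixed interior point of P lies in P.

Direct half. A discrete Γ acts properly discontinuously (`finite_of_isCompact`), so some x lies on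
no mirror. Let the walls be the mirrors H such that no other mirror separates x from r_H x. A
descent on the height of x shows that they generate Γ (`IsGeneric.reflection_mem`). If π/φ were not
an integer for two walls at angle φ, their dihedral group would yield a mirror that separates x from
its image in a wall (`IsGeneric.coxeterAngles`). That the walls bound a fundamental domain then
follows from the converse half. -/

theorem form_add_right (e x y : Ambient G n) : form e (x + y) = form e x + form e y := by
  cases G
  · simp only [form, inner_add_right]
  · simp only [form, inner_add_right]
  · simp only [form, lorentz_eq, inner_add_right, PiLp.add_apply]
    ring

theorem form_smul_right (e x : Ambient G n) (t : ℝ) : form e (t • x) = t * form e x := by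
  cases G
  · simp only [form, inner_smul_right]
  · simp only [form, inner_smul_right]
  · simp only [form, lorentz_eq, inner_smul_right, PiLp.smul_apply, smul_eq_mul]
    ring

/-- The functional `(e, ·)` on `V`. -/
def formLin (e : Ambient G n) : Ambient G n →ₗ[ℝ] ℝ where
  toFun := form e
  map_add' := form_add_right e
  map_smul' t x := form_smul_right e x t

theorem form_sub_right (e x y : Ambient G n) : form e (x - y) = form e x - form e y :=
  (formLin e).map_sub x y

theorem form_neg_right (e x : Ambient G n) : form e (-x) = -form e x := (formLin e).map_neg x

theorem form_sum_right {ι : Type*} (s : Finset ι) (e : Ambient G n) (x : ι → Ambient G n) :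
    form e (∑ i ∈ s, x i) = ∑ i ∈ s, form e (x i) := map_sum (formLin e) x s

theorem form_sub_left (e x y : Ambient G n) : form (x - y) e = form x e - form y e := by
  simp only [form_comm _ e, form_sub_right]

theorem form_neg_left (e x : Ambient G n) : form (-x) e = -form x e := by
  simp only [form_comm _ e, form_neg_right]

theorem form_smul_left (e x : Ambient G n) (t : ℝ) : form (t • x) e = t * form x e := by
  simp only [form_comm _ e, form_smul_right]

theorem form_smul_sub_smul_self (x y : Ambient G n) (a b : ℝ) :
    form (a • x - b • y) (a • x - b • y)
      = a ^ 2 * form x x - 2 * a * b * form x y + b ^ 2 * form y y := by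
  simp only [form_sub_left, form_sub_right, form_smul_left, form_smul_right, form_comm y x]
  ring

theorem form_sub_self (x y : Ambient G n) :
    form (x - y) (x - y) = form x x - 2 * form x y + form y y := by
  simp only [form_sub_left, form_sub_right, form_comm y x]
  ring

/-! ### Signed heights and the algebra of reflections -/

namespace Halfspace

/-- The signed height of a point over the bounding hyperplane. -/
def eval (H : Halfspace G n) (x : Space G n) : ℝ := form H.normal x.1 - H.offset

theorem mem_hyperplane {H : Halfspace G n} {x : Space G n} : x ∈ H.hyperplane ↔ H.eval x = 0 :=
  (sub_eq_zero (a := form H.normal x.1) (b := H.offset)).symm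

theorem mem_carrier {H : Halfspace G n} {x : Space G n} : x ∈ H.carrier ↔ 0 ≤ H.eval x :=
  (sub_nonneg (a := form H.normal x.1) (b := H.offset)).symm

theorem continuous_eval (H : Halfspace G n) : Continuous H.eval :=
  ((continuous_form H.normal).comp continuous_subtype_val).sub continuous_const

theorem coe_reflection (H : Halfspace G n) (x : Space G n) :
    (H.reflection.1 x).1 = x.1 - (2 * H.eval x) • H.normal := rfl

theorem eval_reflection (H K : Halfspace G n) (x : Space G n) :
    H.eval (K.reflection.1 x) = H.eval x - 2 * form H.normal K.normal * K.eval x := by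
  simp only [eval, coe_reflection, form_sub_right, form_smul_right]
  ring

theorem eval_reflection_self (H : Halfspace G n) (x : Space G n) :
    H.eval (H.reflection.1 x) = -H.eval x := by
  rw [eval_reflection, H.unit]
  ring

theorem reflection_reflection (H : Halfspace G n) (x : Space G n) :
    H.reflection.1 (H.reflection.1 x) = x :=
  H.reflectHomeo.left_inv x

theorem reflection_mul_self (H : Halfspace G n) : H.reflection * H.reflection = 1 :=
  Subtype.ext (Homeomorph.ext H.reflection_reflection)

theorem reflection_inv (H : Halfspace G n) : H.reflection⁻¹ = H.reflection :=
  inv_eq_of_mul_eq_one_left H.reflection_mul_self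

theorem reflection_eq_self_iff {H : Halfspace G n} {x : Space G n} :
    H.reflection.1 x = x ↔ H.eval x = 0 := by
  constructor
  · intro h
    have := H.eval_reflection_self x
    rw [h] at this
    linarith
  · intro h
    apply Subtype.ext
    rw [coe_reflection, h]
    simp

/-- The opposite halfspace. -/
def opposite (H : Halfspace G n) : Halfspace G n where
  normal := -H.normal
  offset := -H.offset
  unit := by rw [form_neg_left, form_neg_right, neg_neg, H.unit]
  offset_eq_zero h := by rw [H.offset_eq_zero h, neg_zero]

theorem eval_opposite (H : Halfspace G n) (x : Space G n) : H.opposite.eval x = -H.eval x := by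
  simp only [eval, opposite, form_neg_left]
  ring

theorem reflection_opposite (H : Halfspace G n) : H.opposite.reflection = H.reflection := by
  refine Subtype.ext (Homeomorph.ext fun x => Subtype.ext ?_)
  rw [coe_reflection, coe_reflection, eval_opposite]
  simp [opposite]

/-- The image of the halfspace `H` under the reflection in `K`. -/
def image (K H : Halfspace G n) : Halfspace G n where
  normal := H.normal - (2 * form H.normal K.normal) • K.normal
  offset := H.offset - 2 * form H.normal K.normal * K.offset
  unit := by
    simp only [form_sub_right, form_sub_left, form_smul_left, form_smul_right, H.unit, K.unit,
      form_comm K.normal H.normal]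
    ring
  offset_eq_zero h := by rw [H.offset_eq_zero h, K.offset_eq_zero h]; ring

theorem eval_image (K H : Halfspace G n) (x : Space G n) :
    (K.image H).eval x = H.eval (K.reflection.1 x) := by
  rw [eval_reflection]
  simp only [eval, image, form_sub_left, form_smul_left]
  ring

theorem reflection_image (K H : Halfspace G n) :
    (K.image H).reflection = K.reflection * H.reflection * K.reflection := by
  refine Subtype.ext (Homeomorph.ext fun x => Subtype.ext ?_)
  change _ = (K.reflection.1 (H.reflection.1 (K.reflection.1 x))).1
  rw [coe_reflection (K.image H), eval_image, coe_reflection K, coe_reflection H,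
    eval_reflection K H, eval_reflection_self, coe_reflection, eval_reflection,
    form_comm K.normal H.normal]
  simp only [image]
  module

end Halfspace

/-! ### The squared chord as a substitute for the distance -/

/-- The form of the difference of two points, a substitute for the distance. -/
def sqDist (x y : Space G n) : ℝ := form (x.1 - y.1) (x.1 - y.1)

theorem sqDist_self (x : Space G n) : sqDist x x = 0 := by
  have := form_smul_right (x.1 - x.1) 0 0
  rwa [zero_smul, zero_mul, ← sub_self x.1] at this

theorem sqDist_comm (x y : Space G n) : sqDist x y = sqDist y x := by
  simp only [sqDist, form_sub_left, form_sub_right]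
  ring

theorem continuous_sqDist {Y : Type*} [TopologicalSpace Y] {f g : Y → Space G n}
    (hf : Continuous f) (hg : Continuous g) : Continuous fun y => sqDist (f y) (g y) := by
  cases G
  · simp only [sqDist, form]; fun_prop
  · simp only [sqDist, form]; fun_prop
  · simp only [sqDist, form, lorentz]; fun_prop

theorem sqDist_reflection (H : Halfspace G n) (x y : Space G n) :
    sqDist (H.reflection.1 x) (H.reflection.1 y) = sqDist x y := by
  simp only [sqDist, Halfspace.coe_reflection, form_sub_left, form_sub_right, form_smul_left,
    form_smul_right, H.unit, Halfspace.eval, form_comm _ H.normal]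
  ring

/-- Source of the extremal arguments: a reflection brings x nearer to y exactly when H strictly
separates them. -/
theorem sqDist_reflection_left (H : Halfspace G n) (x y : Space G n) :
    sqDist (H.reflection.1 x) y = sqDist x y + 4 * H.eval x * H.eval y := by
  simp only [sqDist, Halfspace.coe_reflection, form_sub_left, form_sub_right, form_smul_left,
    form_smul_right, H.unit, Halfspace.eval, form_comm _ H.normal]
  ring

theorem sqDist_reflection_reflection (H K : Halfspace G n) (x : Space G n) :
    sqDist (H.reflection.1 x) (K.reflection.1 x) = 4 * (H.eval x ^ 2 + K.eval x ^ 2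
      - 2 * form H.normal K.normal * H.eval x * K.eval x) := by
  rw [sqDist_reflection_left, sqDist_comm, sqDist_reflection_left, sqDist_self,
    Halfspace.eval_reflection]
  ring

theorem lorentz_self {n : ℕ} (x : EuclideanSpace ℝ (Fin (n + 1))) :
    lorentz x x = ‖x‖ ^ 2 - 2 * x 0 ^ 2 := by
  rw [lorentz_eq, real_inner_self_eq_norm_sq]
  ring

theorem sqDist_hyperbolic (x y : Space .hyperbolic n) :
    sqDist x y = -2 - 2 * lorentz x.1 y.1 := by
  have h := form_sub_self (G := .hyperbolic) (n := n) x.1 y.1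
  change sqDist x y = lorentz x.1 x.1 - 2 * lorentz x.1 y.1 + lorentz y.1 y.1 at h
  rw [h, x.2.1, y.2.1]
  ring

/-- The Cauchy–Schwarz inequality for the spacelike parts of two vectors. -/
theorem sq_lorentz_add_le {n : ℕ} (x y : EuclideanSpace ℝ (Fin (n + 1))) :
    (lorentz x y + x 0 * y 0) ^ 2 ≤ (lorentz x x + x 0 ^ 2) * (lorentz y y + y 0 ^ 2) := by
  have := Finset.sum_mul_sq_le_sq_mul_sq Finset.univ (fun i : Fin n => x i.succ)
    (fun i : Fin n => y i.succ)
  have h : ∀ u v : EuclideanSpace ℝ (Fin (n + 1)),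
      lorentz u v + u 0 * v 0 = ∑ i : Fin n, u i.succ * v i.succ := fun u v => by
    simp only [lorentz]
    ring
  rw [pow_two (x 0), pow_two (y 0), h, h, h]
  simpa only [pow_two] using this

theorem one_le_coord (x : Space .hyperbolic n) : 1 ≤ x.1 0 := by
  have h := x.2.1
  simp only [lorentz] at h
  have : 0 ≤ ∑ i : Fin n, x.1 i.succ * x.1 i.succ := Finset.sum_nonneg fun i _ => mul_self_nonneg _
  nlinarith [x.2.2]

theorem sqDist_nonneg (x y : Space G n) : 0 ≤ sqDist x y := by
  cases G
  · exact real_inner_self_nonneg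
  · exact real_inner_self_nonneg
  · have h := sq_lorentz_add_le x.1 y.1
    rw [sqDist_hyperbolic]
    rw [x.2.1, y.2.1] at h
    have hx := one_le_coord x
    have hy := one_le_coord y
    -- Cauchy–Schwarz bounds the square by (x₀² - 1)(y₀² - 1) ≤ (x₀y₀ - 1)², whence (x,y) ≤ -1.
    nlinarith [abs_le_of_sq_le_sq' (a := lorentz x.1 y.1 + x.1 0 * y.1 0) (b := x.1 0 * y.1 0 - 1)
      (by nlinarith [sq_nonneg (x.1 0 - y.1 0)]) (by nlinarith)]

theorem eq_of_sqDist_eq_zero {x y : Space G n} (h0 : sqDist x y = 0) : x = y := by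
  cases G
  · exact Subtype.ext (sub_eq_zero.1 (inner_self_eq_zero.1 h0))
  · exact Subtype.ext (sub_eq_zero.1 (inner_self_eq_zero.1 h0))
  · have h := sq_lorentz_add_le x.1 y.1
    have h1 := h0
    rw [sqDist_hyperbolic] at h1
    rw [x.2.1, y.2.1, show lorentz x.1 y.1 = -1 by linarith] at h
    -- Equality in the previous estimate forces equal time coordinates; on differences with
    -- vanishing time coordinate the form is the Euclidean one.
    have h2 : x.1 0 - y.1 0 = 0 := by
      have : (x.1 0 - y.1 0) ^ 2 ≤ 0 := by nlinarith
      exact pow_eq_zero_iff two_ne_zero |>.1 (le_antisymm this (sq_nonneg _))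
    change lorentz (x.1 - y.1) (x.1 - y.1) = 0 at h0
    rw [lorentz_self, PiLp.sub_apply, h2] at h0
    apply Subtype.ext
    rw [← sub_eq_zero, ← norm_eq_zero]
    exact pow_eq_zero_iff two_ne_zero |>.1 (by linarith)

theorem isClosed_points : IsClosed (points G n) := by
  cases G
  · exact isClosed_univ
  · exact isClosed_eq continuous_norm continuous_const
  · have : points .hyperbolic n = {x | lorentz x x = -1} ∩ {x | 1 ≤ x 0} := by
      ext x
      exact ⟨fun h => ⟨h.1, one_le_coord ⟨x, h⟩⟩, fun h => ⟨h.1, one_pos.trans_le h.2⟩⟩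
    rw [this]
    refine (isClosed_eq ?_ continuous_const).inter (isClosed_le continuous_const ?_)
    · simp only [lorentz]; fun_prop
    · fun_prop

theorem isCompact_norm_le (R : ℝ) : IsCompact {x : Space G n | ‖x.1‖ ≤ R} := by
  have := isClosed_points.isClosedEmbedding_subtypeVal.isCompact_preimage
    (isCompact_closedBall (0 : Ambient G n) R)
  convert this using 1
  ext x
  simp

theorem exists_norm_le {K : Set (Space G n)} (hK : IsCompact K) (C : ℝ) :
    ∃ R, ∀ p ∈ K, ∀ y, sqDist y p ≤ C → ‖y.1‖ ≤ R := by
  obtain ⟨B, hB⟩ := (hK.image continuous_subtype_val).isBounded.exists_norm_le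
  have hB' : ∀ p ∈ K, ‖p.1‖ ≤ B := fun p hp => hB _ ⟨p, hp, rfl⟩
  cases G
  · refine ⟨B + (|C| + 1), fun p hp y hy => ?_⟩
    change inner ℝ (y.1 - p.1) (y.1 - p.1) ≤ C at hy
    rw [real_inner_self_eq_norm_sq] at hy
    have h1 := hB' p hp
    have h2 : ‖y.1‖ ≤ ‖p.1‖ + ‖y.1 - p.1‖ := norm_le_insert' _ _
    have h3 : ‖y.1 - p.1‖ ≤ |C| + 1 := by
      nlinarith [le_abs_self C, abs_nonneg C, norm_nonneg (y.1 - p.1)]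
    linarith
  · exact ⟨1, fun p _ y _ => le_of_eq y.2⟩
  · refine ⟨2 * (2 * (1 + |C|) * |B|), fun p hp y hy => ?_⟩
    have h := sq_lorentz_add_le y.1 p.1
    rw [y.2.1, p.2.1] at h
    rw [sqDist_hyperbolic] at hy
    set M := 1 + |C| with hM
    have hM1 : -lorentz y.1 p.1 ≤ M := by linarith [le_abs_self C, abs_nonneg C]
    have hM0 : 1 ≤ M := by linarith [abs_nonneg C]
    have hx := one_le_coord p
    have hy1 := one_le_coord y
    -- If y₀p₀ > M, then (y₀p₀ - M)² ≤ (y₀² - 1)(p₀² - 1), and cancelling y₀²p₀² bounds y₀. The norm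
    -- is controlled by y₀ because ‖y‖² = 2y₀² - 1.
    have h3 : y.1 0 ≤ 2 * M * p.1 0 := by
      by_cases hc : y.1 0 * p.1 0 ≤ M
      · nlinarith
      · push Not at hc
        have h4 : (y.1 0 * p.1 0 - M) ^ 2 ≤ (lorentz y.1 p.1 + y.1 0 * p.1 0) ^ 2 := by
          apply pow_le_pow_left₀ <;> linarith
        have h5 : y.1 0 * y.1 0 ≤ y.1 0 * (2 * M * p.1 0) := by nlinarith
        exact le_of_mul_le_mul_left h5 (by linarith)
    have h6 : p.1 0 ≤ |B| := by
      have := (PiLp.norm_apply_le p.1 0).trans (hB' p hp)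
      rw [Real.norm_eq_abs] at this
      exact (le_abs_self _).trans (this.trans (le_abs_self _))
    have h7 : ‖y.1‖ ≤ 2 * y.1 0 := by
      have h8 := lorentz_self y.1
      rw [y.2.1] at h8
      nlinarith [norm_nonneg y.1]
    nlinarith

/-- The points at bounded distance from a compact set form a relatively compact set. -/
theorem exists_isCompact_sqDist {K : Set (Space G n)} (hK : IsCompact K) (C : ℝ) :
    ∃ Q : Set (Space G n), IsCompact Q ∧ ∀ p ∈ K, ∀ y, sqDist y p ≤ C → y ∈ Q :=
  let ⟨R, hR⟩ := exists_norm_le hK C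
  ⟨_, isCompact_norm_le R, hR⟩

/-- Outside the interior of U, within a compact set containing the unit sublevel set, `sqDist` to x
has a positive minimum; so its sublevel sets shrink to x in the topology. -/
theorem exists_sqDist_lt_mem {x : Space G n} {U : Set (Space G n)} (hU : U ∈ nhds x) :
    ∃ δ > 0, ∀ y, sqDist y x < δ → y ∈ U := by
  obtain ⟨Q, hQ, hQm⟩ := exists_isCompact_sqDist (isCompact_singleton (x := x)) 1
  have hc : Continuous fun y : Space G n => sqDist y x :=
    continuous_sqDist continuous_id continuous_const
  have hQ' := hQ.diff (isOpen_interior (s := U))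
  rcases (Q \ interior U).eq_empty_or_nonempty with he | hne
  · exact ⟨1, one_pos, fun y hy => interior_subset
      (by simpa using fun hn => (he.subset ⟨hQm x rfl y hy.le, hn⟩ : y ∈ (∅ : Set _)))⟩
  · obtain ⟨z, hz, hmin⟩ := hQ'.exists_isMinOn hne hc.continuousOn
    have hpos : 0 < sqDist z x := (sqDist_nonneg z x).lt_of_ne fun h => hz.2 <| by
      rw [eq_of_sqDist_eq_zero h.symm]
      exact mem_interior_iff_mem_nhds.2 hU
    refine ⟨min 1 (sqDist z x), lt_min one_pos hpos, fun y hy => ?_⟩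
    by_contra hyU
    have := hmin (a := y) ⟨hQm x rfl y (hy.le.trans (min_le_left _ _)),
      fun h => hyU (interior_subset h)⟩
    exact absurd (hy.trans_le (min_le_right _ _)) (not_lt.2 this)

/-! ### Points near a hyperplane and nested halfspaces -/

/-- A curve that leaves a hyperplane into its negative side. -/
theorem Halfspace.exists_curve (H : Halfspace G n) {x : Space G n} (hx : H.eval x = 0) :
    ∃ γ : ℝ → Space G n, Continuous γ ∧ γ 0 = x ∧ ∀ t, 0 < t → t < 1 → H.eval (γ t) < 0 := by
  cases G
  · refine ⟨fun t => ⟨x.1 - t • H.normal, trivial⟩, by fun_prop, by simp, fun t h0 _ => ?_⟩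
    change form H.normal x.1 - H.offset = 0 at hx
    change form H.normal (x.1 - t • H.normal) - H.offset < 0
    rw [form_sub_right, form_smul_right, H.unit]
    linarith
  · have h0 := H.offset_eq_zero (by simp)
    have hx' : form H.normal x.1 = 0 := by simpa [Halfspace.eval, h0] using hx
    have hxx : form (G := .spherical) (n := n) x.1 x.1 = 1 := by
      have : ‖x.1‖ = 1 := x.2
      simp [form, this]
    -- Since x is orthogonal to the unit normal, this is the geodesic through x perpendicular to the
    -- hyperplane; the hyperbolic case uses cosh and sinh.
    have hmem : ∀ t : ℝ, Real.cos t • x.1 - Real.sin t • H.normal ∈ points .spherical n := by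
      intro t
      have : form (G := .spherical) (n := n) (Real.cos t • x.1 - Real.sin t • H.normal)
          (Real.cos t • x.1 - Real.sin t • H.normal) = 1 := by
        rw [form_smul_sub_smul_self, H.unit, hxx, form_comm x.1 H.normal, hx']
        nlinarith [Real.sin_sq_add_cos_sq t]
      simp only [form, real_inner_self_eq_norm_sq] at this
      exact (pow_eq_one_iff_of_nonneg (norm_nonneg _) two_ne_zero).1 this
    refine ⟨fun t => ⟨_, hmem t⟩, by fun_prop, Subtype.ext (by simp), fun t ht0 ht1 => ?_⟩
    change form H.normal (Real.cos t • x.1 - Real.sin t • H.normal) - H.offset < 0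
    rw [form_sub_right, form_smul_right, form_smul_right, H.unit, hx', h0]
    linarith [Real.sin_pos_of_pos_of_lt_pi ht0 (by linarith [Real.pi_gt_three])]
  · have h0 := H.offset_eq_zero (by simp)
    have hx' : form H.normal x.1 = 0 := by simpa [Halfspace.eval, h0] using hx
    have hxx : form (G := .hyperbolic) (n := n) x.1 x.1 = -1 := x.2.1
    have hmem : ∀ t : ℝ, Real.cosh t • x.1 - Real.sinh t • H.normal ∈ points .hyperbolic n := by
      intro t
      have h1 : form (G := .hyperbolic) (n := n) (Real.cosh t • x.1 - Real.sinh t • H.normal)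
          (Real.cosh t • x.1 - Real.sinh t • H.normal) = -1 := by
        rw [form_smul_sub_smul_self, H.unit, hxx, form_comm x.1 H.normal, hx']
        nlinarith [Real.cosh_sq t]
      refine ⟨h1, lorentz_pos_of_neg x.1 _ x.2.1 h1 x.2.2 ?_⟩
      change form (G := .hyperbolic) (n := n) x.1 _ ≤ 0
      rw [form_sub_right, form_smul_right, form_smul_right, form_comm x.1 H.normal, hx', hxx]
      linarith [Real.cosh_pos t]
    refine ⟨fun t => ⟨_, hmem t⟩, ?_, Subtype.ext (by simp), fun t ht0 _ => ?_⟩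
    · exact Continuous.subtype_mk ((Real.continuous_cosh.smul continuous_const).sub
        (Real.continuous_sinh.smul continuous_const)) _
    change form H.normal (Real.cosh t • x.1 - Real.sinh t • H.normal) - H.offset < 0
    rw [form_sub_right, form_smul_right, form_smul_right, H.unit, hx', h0]
    linarith [Real.sinh_pos_iff.2 ht0]

theorem Halfspace.exists_eval_neg (H : Halfspace G n) {x : Space G n} (hx : H.eval x = 0)
    {U : Set (Space G n)} (hU : U ∈ nhds x) : ∃ y ∈ U, H.eval y < 0 := by
  obtain ⟨γ, hc, h0, hneg⟩ := H.exists_curve hx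
  have h1 : ∀ᶠ t in nhdsWithin (0 : ℝ) (Set.Ioi 0), γ t ∈ U :=
    (hc.continuousAt.eventually (by rwa [h0])).filter_mono nhdsWithin_le_nhds
  obtain ⟨t, ht, ht'⟩ := (h1.and (Ioo_mem_nhdsGT one_pos)).exists
  exact ⟨_, ht, hneg t ht'.1 ht'.2⟩

/-- For a vector that is not spacelike, v₀x₀ dominates the spacelike part of the product, so the
sign of v₀ decides on the whole sheet. -/
theorem lorentz_nonpos_or_nonneg {n : ℕ} (v : EuclideanSpace ℝ (Fin (n + 1)))
    (hv : lorentz v v ≤ 0) :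
    (∀ x ∈ points .hyperbolic n, lorentz v x ≤ 0) ∨
      ∀ x ∈ points .hyperbolic n, 0 ≤ lorentz v x := by
  have key : ∀ x ∈ points .hyperbolic n, (lorentz v x + v 0 * x 0) ^ 2 ≤ (v 0 * x 0) ^ 2 := by
    intro x hx
    have h := sq_lorentz_add_le v x
    rw [hx.1] at h
    have h1 := one_le_coord ⟨x, hx⟩
    have h2 : (lorentz v v + v 0 ^ 2) * (-1 + x 0 ^ 2) ≤ v 0 ^ 2 * (-1 + x 0 ^ 2) :=
      mul_le_mul_of_nonneg_right (by linarith) (by nlinarith)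
    nlinarith [sq_nonneg (v 0)]
  rcases le_total 0 (v 0) with h | h
  · left
    intro x hx
    have := (abs_le_of_sq_le_sq' (key x hx) (mul_nonneg h hx.2.le)).2
    linarith
  · right
    intro x hx
    have h1 := key x hx
    rw [← neg_sq (v 0 * x 0)] at h1
    have := (abs_le_of_sq_le_sq' h1 (by nlinarith [hx.2])).1
    linarith

/-- The difference of the normals has form 2 - 2(e₁,e₂) ≤ 0. It vanishes in the Euclidean and
spherical cases and has constant sign on the sheet in the hyperbolic one, so the halfspaces are
nested. -/
theorem Halfspace.eval_le_or_le {H K : Halfspace G n} (h : 1 ≤ form H.normal K.normal) :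
    (∀ x, H.eval x ≤ K.eval x) ∨ ∀ x, K.eval x ≤ H.eval x := by
  have hv : form (H.normal - K.normal) (H.normal - K.normal) ≤ 0 := by
    simp only [form_sub_left, form_sub_right, H.unit, K.unit, form_comm K.normal H.normal]
    linarith
  have he : ∀ x, H.eval x - K.eval x
      = form (H.normal - K.normal) x.1 - (H.offset - K.offset) := fun x => by
    simp only [Halfspace.eval, form_sub_left]
    ring
  cases G
  · have h0 : H.normal - K.normal = 0 := by
      apply inner_self_eq_zero.1 (le_antisymm hv real_inner_self_nonneg)
    simp only [h0, form, inner_zero_left] at he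
    rcases le_total H.offset K.offset with h1 | h1
    · exact Or.inr fun x => by linarith [he x]
    · exact Or.inl fun x => by linarith [he x]
  · have h0 : H.normal - K.normal = 0 := by
      apply inner_self_eq_zero.1 (le_antisymm hv real_inner_self_nonneg)
    simp only [h0, form, inner_zero_left] at he
    rcases le_total H.offset K.offset with h1 | h1
    · exact Or.inr fun x => by linarith [he x]
    · exact Or.inl fun x => by linarith [he x]
  · simp only [H.offset_eq_zero (by simp), K.offset_eq_zero (by simp)] at he
    rcases lorentz_nonpos_or_nonneg _ hv with h1 | h1
    · exact Or.inl fun x => by linarith [he x, show form _ x.1 ≤ 0 from h1 x.1 x.2]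
    · exact Or.inr fun x => by linarith [he x, show 0 ≤ form _ x.1 from h1 x.1 x.2]

/-! ### Proper discontinuity of discrete groups generated by reflections -/

theorem mul_apply (g h : Iso G n) (x : Space G n) : (g * h).1 x = g.1 (h.1 x) := rfl

theorem inv_apply_apply (g : Iso G n) (x : Space G n) : (g⁻¹).1 (g.1 x) = x :=
  g.1.symm_apply_apply x

theorem apply_inv_apply (g : Iso G n) (x : Space G n) : g.1 ((g⁻¹).1 x) = x :=
  g.1.apply_symm_apply x

theorem Iso.ext {g h : Iso G n} (H : ∀ x, g.1 x = h.1 x) : g = h := Subtype.ext (Homeomorph.ext H)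

/-- The group generated by all reflections. -/
def fullGroup (G : Geometry) (n : ℕ) : Subgroup (Iso G n) :=
  Subgroup.closure (Set.range Halfspace.reflection)

theorem closure_reflection_le (S : Set (Halfspace G n)) :
    Subgroup.closure (Halfspace.reflection '' S) ≤ fullGroup G n :=
  Subgroup.closure_mono (Set.image_subset_range _ _)

theorem sqDist_apply {g : Iso G n} (hg : g ∈ fullGroup G n) :
    ∀ x y, sqDist (g.1 x) (g.1 y) = sqDist x y := by
  induction hg using Subgroup.closure_induction with
  | mem g hg =>
    obtain ⟨H, rfl⟩ := hg
    exact sqDist_reflection H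
  | one => exact fun x y => rfl
  | mul g h _ _ hg hh => exact fun x y => (hg _ _).trans (hh x y)
  | inv g _ hg =>
    intro x y
    rw [← hg, apply_inv_apply, apply_inv_apply]

/-- A finite family of points through which every motion can be interpolated. -/
structure Frame (G : Geometry) (n : ℕ) where
  /-- the index type -/
  ι : Type
  fintype : Fintype ι
  point : ι → Space G n
  coeff : ι → Space G n → ℝ
  continuous_coeff : ∀ i, Continuous (coeff i)
  coe_eq_sum : ∀ x, x.1 = ∑ i, coeff i x • (point i).1
  sum_mul_offset : ∀ (H : Halfspace G n) x, (∑ i, coeff i x) * H.offset = H.offset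

attribute [instance] Frame.fintype

/-- In the Euclidean case the coefficients are barycentric, with sum 1; in the others the offset is
0 and linear coordinates suffice. The factor √2 puts √2·e₀ + eᵢ on the hyperboloid, as -2 + 1 = -1.
-/
theorem nonempty_frame : Nonempty (Frame G n) := by
  cases G
  · refine ⟨⟨Option (Fin n), inferInstance,
      fun o => ⟨o.elim 0 fun i => EuclideanSpace.single i 1, trivial⟩,
      fun o x => o.elim (1 - ∑ i, x.1 i) fun i => x.1 i, ?_, fun x => ?_, fun H x => ?_⟩⟩
    · rintro (_ | i)
      · simp only [Option.elim]; fun_prop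
      · simp only [Option.elim]; fun_prop
    · ext j
      simp [Fintype.sum_option, Pi.single_apply]
    · simp [Fintype.sum_option]
  · refine ⟨⟨Fin (n + 1), inferInstance,
      fun i => ⟨EuclideanSpace.single i 1, by simp [points]⟩,
      fun i x => x.1 i, fun i => by fun_prop, fun x => ?_, fun H x => ?_⟩⟩
    · ext j
      simp [Pi.single_apply]
    · rw [H.offset_eq_zero (by simp), mul_zero]
  · refine ⟨⟨Option (Fin n), inferInstance, fun o => ⟨o.elim (EuclideanSpace.single 0 1)
        fun i => EuclideanSpace.single 0 (√2) + EuclideanSpace.single i.succ 1, ?_⟩,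
      fun o x => o.elim (x.1 0 - √2 * ∑ i : Fin n, x.1 i.succ) fun i => x.1 i.succ,
      ?_, fun x => ?_, fun H x => ?_⟩⟩
    · rcases o with _ | i
      · simp [points, lorentz]
      · simp [points, lorentz]
        norm_num
    · rintro (_ | i)
      · simp only [Option.elim]; fun_prop
      · simp only [Option.elim]; fun_prop
    · ext j
      refine Fin.cases ?_ (fun j => ?_) j
      · simp [Fintype.sum_option, Finset.mul_sum, mul_comm]
      · simp [Fintype.sum_option, Pi.single_apply]
    · rw [H.offset_eq_zero (by simp), mul_zero]

/-- Reflections are affine on V, and linear when the offset is 0, so they respect the interpolation.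
Products of reflections inherit this by induction, without any extension theorem for general
isometries. -/
theorem Frame.coe_apply (F : Frame G n) {g : Iso G n} (hg : g ∈ fullGroup G n) (x : Space G n) :
    (g.1 x).1 = ∑ i, F.coeff i x • (g.1 (F.point i)).1 := by
  have step : ∀ (H : Halfspace G n) (g : Iso G n),
      (g.1 x).1 = ∑ i, F.coeff i x • (g.1 (F.point i)).1 →
      ((H.reflection * g).1 x).1 = ∑ i, F.coeff i x • ((H.reflection * g).1 (F.point i)).1 := by
    intro H g hg
    have he : H.eval (g.1 x) = ∑ i, F.coeff i x * H.eval (g.1 (F.point i)) := by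
      simp only [Halfspace.eval, mul_sub, Finset.sum_sub_distrib, ← Finset.sum_mul,
        F.sum_mul_offset]
      rw [hg, form_sum_right]
      simp only [form_smul_right]
    simp only [mul_apply, Halfspace.coe_reflection, smul_sub, Finset.sum_sub_distrib]
    rw [← hg, he, Finset.mul_sum, Finset.sum_smul]
    congr 1
    refine Finset.sum_congr rfl fun i _ => ?_
    module
  induction hg using Subgroup.closure_induction_left with
  | one => exact F.coe_eq_sum x
  | mul_left g hg h _ ih =>
    obtain ⟨H, rfl⟩ := hg
    exact step H h ih
  | inv_mul_cancel g hg h _ ih =>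
    obtain ⟨H, rfl⟩ := hg
    rw [Halfspace.reflection_inv]
    exact step H h ih

theorem Frame.eq_of_apply_eq (F : Frame G n) {g h : Iso G n} (hg : g ∈ fullGroup G n)
    (hh : h ∈ fullGroup G n) (H : ∀ i, g.1 (F.point i) = h.1 (F.point i)) : g = h := by
  refine Iso.ext fun x => Subtype.ext ?_
  rw [F.coe_apply hg, F.coe_apply hh]
  simp only [H]

/-- An element of a discrete group that moves the points of a frame little is trivial. -/
theorem Frame.exists_nhds (F : Frame G n) {Γ : Subgroup (Iso G n)} [hd : DiscreteTopology Γ]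
    (hΓ : Γ ≤ fullGroup G n) : ∃ U : F.ι → Set (Space G n), (∀ i, U i ∈ nhds (F.point i)) ∧
      ∀ g ∈ Γ, (∀ i, g.1 (F.point i) ∈ U i) → g = 1 := by
  obtain ⟨O, hO, hO1⟩ := isOpen_induced_iff.1 (isOpen_discrete ({1} : Set Γ))
  obtain ⟨O', hO', rfl⟩ := isOpen_induced_iff.1 hO
  have hind : Topology.IsInducing
      fun f : C(Space G n, Space G n) => (ContinuousMap.mk Subtype.val continuous_subtype_val :
        C(Space G n, Ambient G n)).comp f := by
    exact ContinuousMap.isInducing_postcomp _ Topology.IsInducing.subtypeVal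
  obtain ⟨O'', hO'', rfl⟩ := hind.isOpen_iff.1 hO'
  -- An arbitrary choice of images of the frame points interpolates to a map into V, not into the
  -- space. For the images under a motion in `fullGroup` it returns that motion, and it depends
  -- continuously on the images.
  let Ψ : (F.ι → Space G n) → C(Space G n, Ambient G n) := fun p =>
    ⟨fun x => ∑ i, F.coeff i x • (p i).1, continuous_finsetSum _ fun i _ =>
      (F.continuous_coeff i).smul continuous_const⟩
  have hΨ : Continuous Ψ := by
    refine ContinuousMap.continuous_of_continuous_uncurry _ ?_
    refine continuous_finsetSum _ fun i _ => ?_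
    have := F.continuous_coeff i
    exact (this.comp continuous_snd).smul
      (continuous_subtype_val.comp ((continuous_apply i).comp continuous_fst))
  have key : ∀ g (hg : g ∈ Γ), Ψ (fun i => g.1 (F.point i)) ∈ O'' ↔ g = 1 := by
    intro g hg
    have h1 := Set.ext_iff.1 hO1 ⟨g, hg⟩
    rw [Set.mem_singleton_iff, ← Subtype.coe_inj] at h1
    refine Iff.trans ?_ h1
    have : Ψ (fun i => g.1 (F.point i))
        = (ContinuousMap.mk Subtype.val continuous_subtype_val :
        C(Space G n, Ambient G n)).comp (g.1 : C(Space G n, Space G n)) := by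
      ext1 x
      exact (F.coe_apply (hΓ hg) x).symm
    rw [this]
    rfl
  have hmem : Ψ ⁻¹' O'' ∈ nhds F.point :=
    (hO''.preimage hΨ).mem_nhds ((key 1 Γ.one_mem).2 rfl)
  rw [nhds_pi, Filter.mem_pi'] at hmem
  obtain ⟨I, t, ht, hsub⟩ := hmem
  exact ⟨t, ht, fun g hg h => (key g hg).1 (hsub fun i _ => h i)⟩

/-- A discrete group generated by reflections acts properly discontinuously. -/
theorem finite_of_isCompact {Γ : Subgroup (Iso G n)} [DiscreteTopology Γ]
    (hΓ : Γ ≤ fullGroup G n) {K : Set (Space G n)} (hK : IsCompact K) :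
    {g ∈ Γ | ∃ x ∈ K, g.1 x ∈ K}.Finite := by
  obtain ⟨F⟩ := nonempty_frame (G := G) (n := n)
  obtain ⟨U, hU, hU1⟩ := F.exists_nhds hΓ
  choose δ hδ hδU using fun i => exists_sqDist_lt_mem (hU i)
  have hC : ∀ i, ∃ C, ∀ x ∈ K, sqDist (F.point i) x ≤ C := fun i => by
    obtain ⟨C, hC⟩ := hK.bddAbove_image (f := fun x => sqDist (F.point i) x)
      (continuous_sqDist continuous_const continuous_id).continuousOn
    exact ⟨C, fun x hx => hC ⟨x, hx, rfl⟩⟩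
  choose C hC using hC
  choose Q hQ hQm using fun i => exists_isCompact_sqDist hK (C i)
  set T := {g ∈ Γ | ∃ x ∈ K, g.1 x ∈ K}
  let t : Iso G n → F.ι → Space G n := fun g i => g.1 (F.point i)
  have hinj : Set.InjOn t T := fun g hg h hh H =>
    F.eq_of_apply_eq (hΓ hg.1) (hΓ hh.1) (congrFun H)
  -- Frame images of the elements in question lie in a compact product. Infinitely many of them
  -- accumulate, so two distinct elements g, h have nearby images, and h⁻¹g moves the frame so
  -- little that it is trivial.
  by_contra hinf
  obtain ⟨q, -, hq⟩ := ((Set.Infinite.image hinj hinf).exists_accPt_of_subset_isCompact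
    (isCompact_univ_pi hQ) (by
      rintro _ ⟨g, ⟨hg, x, hx, hgx⟩, rfl⟩ i -
      exact hQm i _ hgx _ ((sqDist_apply (hΓ hg) _ _).trans_le (hC i x hx))))
  -- Continuity on the diagonal takes the place of a triangle inequality for `sqDist`.
  have hnear : ∃ V ∈ nhds q, ∀ p ∈ V, ∀ p' ∈ V, ∀ i, sqDist (p i) (p' i) < δ i := by
    have h1 : ∀ᶠ r : (F.ι → Space G n) × (F.ι → Space G n) in nhds (q, q),
        ∀ i, sqDist (r.1 i) (r.2 i) < δ i := by
      rw [Filter.eventually_all]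
      intro i
      have hc : Continuous fun r : (F.ι → Space G n) × (F.ι → Space G n) =>
          sqDist (r.1 i) (r.2 i) := continuous_sqDist
        ((continuous_apply i).comp continuous_fst) ((continuous_apply i).comp continuous_snd)
      exact hc.continuousAt.eventually_lt continuousAt_const (by simpa [sqDist_self] using hδ i)
    rw [nhds_prod_eq] at h1
    obtain ⟨V, hV, hVδ⟩ := Filter.mem_prod_self_iff.1 h1
    exact ⟨V, hV, fun p hp p' hp' => hVδ (Set.mk_mem_prod hp hp')⟩
  obtain ⟨V, hV, hVδ⟩ := hnear
  rw [accPt_iff_nhds] at hq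
  obtain ⟨_, ⟨hp, g, hg, rfl⟩, hpq⟩ := hq V hV
  obtain ⟨_, ⟨hp', h, hh, rfl⟩, hpq'⟩ := hq (V ∩ {t g}ᶜ)
    (Filter.inter_mem hV (isOpen_compl_singleton.mem_nhds (Ne.symm hpq)))
  refine hp'.2 (congrArg t ?_)
  rw [← inv_mul_eq_one]
  refine hU1 _ (Γ.mul_mem (Γ.inv_mem hh.1) hg.1) fun i => hδU i _ ?_
  rw [← sqDist_apply (hΓ hh.1), mul_apply, apply_inv_apply]
  exact hVδ _ hp _ hp'.1 i

end ReflectionGroups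

end

noncomputable section

open scoped Pointwise

/-! ### Alternating words and word length -/

/-- The alternating product `s t s ⋯` of `k` factors. -/
def alternating {M : Type*} [Monoid M] (s t : M) : ℕ → M
  | 0 => 1
  | k + 1 => s * alternating t s k

section Alternating

variable {M : Type*} [Group M] {s t : M}

theorem alternating_succ (s t : M) (k : ℕ) : alternating s t (k + 1) = s * alternating t s k := rfl

theorem alternating_two_mul (s t : M) (k : ℕ) : alternating s t (2 * k) = (s * t) ^ k := by
  induction k with
  | zero => simp [alternating]
  | succ k ih =>
    rw [show 2 * (k + 1) = 2 * k + 1 + 1 by ring, alternating_succ, alternating_succ, ih, pow_succ',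
      mul_assoc]

theorem alternating_mem {S : Set M} (hs : s ∈ S) (ht : t ∈ S) (k : ℕ) :
    alternating s t k ∈ S ^ k := by
  induction k generalizing s t with
  | zero => simp [alternating]
  | succ k ih =>
    rw [pow_succ']
    exact Set.mul_mem_mul hs (ih ht hs)

theorem mul_alternating_self (hs : s * s = 1) (k : ℕ) :
    s * alternating s t (k + 1) = alternating t s k := by
  rw [alternating_succ, ← mul_assoc, hs, one_mul]

/-- Equal neighbouring letters cancel, so a word in two involutions reduces to an alternating one
that is no longer. -/
theorem exists_alternating_of_mem_pow (hs : s * s = 1) (ht : t * t = 1) (k : ℕ) {u : M}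
    (hu : u ∈ ({s, t} : Set M) ^ k) :
    ∃ j ≤ k, u = alternating s t j ∨ u = alternating t s j := by
  induction k generalizing u with
  | zero => exact ⟨0, le_rfl, Or.inl (by simpa [alternating] using hu)⟩
  | succ k ih =>
    rw [pow_succ'] at hu
    obtain ⟨r, hr, v, hv, rfl⟩ := Set.mem_mul.1 hu
    obtain ⟨j, hj, hvj⟩ := ih hv
    have aux : ∀ {s t : M}, s * s = 1 → (v = alternating s t j ∨ v = alternating t s j) →
        ∃ i ≤ k + 1, s * v = alternating s t i ∨ s * v = alternating t s i := by
      rintro s t hs (rfl | rfl)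
      · cases j with
        | zero => exact ⟨1, by omega, Or.inl rfl⟩
        | succ j => exact ⟨j, by omega, Or.inr (mul_alternating_self hs j)⟩
      · exact ⟨j + 1, by omega, Or.inl rfl⟩
    rcases hr with rfl | rfl
    · exact aux hs hvj
    · obtain ⟨i, hi, h⟩ := aux ht hvj.symm
      exact ⟨i, hi, h.symm⟩

/-- The alternating word with 2m letters is trivial, so its initial piece equals the inverse of the
rest, which is the rest read backwards. -/
theorem alternating_sub {m : ℕ} (hs : s * s = 1) (ht : t * t = 1) (hm : (s * t) ^ m = 1) (j : ℕ)
    (hj : j ≤ 2 * m) : alternating s t (2 * m - j) = alternating t s j := by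
  have hm' : (t * s) ^ m = 1 := by
    rw [← inv_inj, ← inv_pow, mul_inv_rev, inv_eq_of_mul_eq_one_left hs,
      inv_eq_of_mul_eq_one_left ht, hm, inv_one]
  induction j generalizing s t with
  | zero => rw [Nat.sub_zero, alternating_two_mul, hm]; rfl
  | succ j ih =>
    have h1 := mul_alternating_self (s := t) (t := s) ht (2 * m - (j + 1))
    rw [← h1, show 2 * m - (j + 1) + 1 = 2 * m - j by omega, ih ht hs hm' (by omega) hm]
    rfl

/-- An alternating word with at least `m` letters can be shortened on the left. -/
theorem exists_mul_alternating_eq {m k : ℕ} (hs : s * s = 1) (ht : t * t = 1)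
    (hm : (s * t) ^ m = 1) (hm2 : 2 ≤ m) (hk : m ≤ k) :
    ∃ j < k,
      s * alternating t s k = alternating s t j ∨ s * alternating t s k = alternating t s j := by
  rw [← alternating_succ]
  -- Up to 2m letters, pass to the complementary word, with 2m - (k + 1) < k letters; beyond that,
  -- delete a trivial prefix of 2m letters.
  rcases le_total (k + 1) (2 * m) with h | h
  · refine ⟨2 * m - (k + 1), by omega, Or.inr ?_⟩
    rw [← alternating_sub hs ht hm _ (by omega)]
    congr 1
    omega
  · refine ⟨k + 1 - 2 * m, by omega, Or.inl ?_⟩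
    have : ∀ i, alternating s t (2 * m + i) = (s * t) ^ m * alternating s t i := by
      intro i
      clear hm hm2 hk h
      induction m with
      | zero => simp
      | succ m ih =>
        rw [show 2 * (m + 1) + i = 2 * m + i + 1 + 1 by ring, alternating_succ, alternating_succ,
          ih, pow_succ']
        simp only [mul_assoc]
    rw [← one_mul (alternating s t (k + 1 - 2 * m)), ← hm, ← this]
    congr 1
    omega

/-- The length of a shortest word in `S` that represents `g`. -/
def wordLength (S : Set M) (g : M) : ℕ := sInf {k | g ∈ S ^ k}

theorem wordLength_le {S : Set M} {g : M} {k : ℕ} (h : g ∈ S ^ k) : wordLength S g ≤ k :=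
  Nat.sInf_le h

/-- Since the generators are involutions, words without inverses exhaust the subgroup and the
infimum is attained. Outside the subgroup `wordLength` has the default value 0, hence the membership
hypothesis. -/
theorem mem_pow_wordLength {S : Set M} (hS : ∀ s ∈ S, s * s = 1) {g : M}
    (hg : g ∈ Subgroup.closure S) : g ∈ S ^ wordLength S g := by
  refine Nat.sInf_mem (s := {k | g ∈ S ^ k}) ?_
  have step : ∀ s ∈ S, ∀ g, (∃ k, g ∈ S ^ k) → ∃ k, s * g ∈ S ^ k := by
    rintro s hs g ⟨k, hk⟩
    exact ⟨k + 1, by rw [pow_succ']; exact Set.mul_mem_mul hs hk⟩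
  change ∃ k, g ∈ S ^ k
  induction hg using Subgroup.closure_induction_left with
  | one => exact ⟨0, by simp⟩
  | mul_left s hs g _ ih => exact step s hs g ih
  | inv_mul_cancel s hs g _ ih =>
    rw [inv_eq_of_mul_eq_one_left (hS s hs)]
    exact step s hs g ih

theorem mem_closure_of_mem_pow {S : Set M} {g : M} {k : ℕ} (h : g ∈ S ^ k) :
    g ∈ Subgroup.closure S := by
  induction k generalizing g with
  | zero => rw [pow_zero, Set.mem_one] at h; exact h ▸ Subgroup.one_mem _
  | succ k ih =>
    rw [pow_succ'] at h
    obtain ⟨s, hs, u, hu, rfl⟩ := Set.mem_mul.1 h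
    exact Subgroup.mul_mem _ (Subgroup.subset_closure hs) (ih hu)

theorem wordLength_mul_le {S : Set M} (hS : ∀ s ∈ S, s * s = 1) {u g : M} {k : ℕ} (hu : u ∈ S ^ k)
    (hg : g ∈ Subgroup.closure S) : wordLength S (u * g) ≤ k + wordLength S g :=
  wordLength_le (by rw [pow_add]; exact Set.mul_mem_mul hu (mem_pow_wordLength hS hg))

end Alternating

namespace ReflectionGroups

variable {G : Geometry} {n : ℕ}

/-! ### Two reflections -/

section Dihedral

variable (H K : Halfspace G n) (y : Space G n)

/-- A Chebyshev recursion in which H and K swap roles at each step: for (e₁,e₂) = -cos φ it reads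
f(k+2) = 2cos φ · f(k+1) - f(k). -/
theorem eval_alternating_add_two (k : ℕ) :
    H.eval ((alternating K.reflection H.reflection (k + 2)).1 y)
      = -H.eval ((alternating K.reflection H.reflection k).1 y) - 2 * form H.normal K.normal *
        K.eval ((alternating H.reflection K.reflection (k + 1)).1 y) := by
  rw [alternating_succ, mul_apply, Halfspace.eval_reflection, alternating_succ, mul_apply,
    Halfspace.eval_reflection_self]

variable {H K}

/-- Here f(k+2) ≥ 2f(k+1) - f(k), so the heights, alternately over H and K, never decrease. -/
theorem eval_alternating_pos_of_le (h : form H.normal K.normal ≤ -1) (hH : 0 < H.eval y)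
    (hK : 0 < K.eval y) (k : ℕ) :
    0 < H.eval ((alternating K.reflection H.reflection k).1 y) := by
  suffices ∀ H K : Halfspace G n, form H.normal K.normal ≤ -1 → 0 < H.eval y → 0 < K.eval y →
      0 < H.eval ((alternating K.reflection H.reflection k).1 y) ∧
      K.eval ((alternating H.reflection K.reflection k).1 y)
        ≤ H.eval ((alternating K.reflection H.reflection (k + 1)).1 y) from
    (this H K h hH hK).1
  clear hH hK h
  induction k with
  | zero =>
    intro H K h hH hK
    refine ⟨hH, ?_⟩
    change K.eval y ≤ H.eval (K.reflection.1 y)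
    rw [Halfspace.eval_reflection]
    nlinarith
  | succ k ih =>
    intro H K h hH hK
    have h' : form K.normal H.normal ≤ -1 := by rwa [form_comm]
    have h1 := ih H K h hH hK
    have h2 := ih K H h' hK hH
    refine ⟨h2.1.trans_le h1.2, ?_⟩
    rw [eval_alternating_add_two]
    nlinarith

/-- The recursion is solved by sines. Parity matters because the larger multiple of φ goes with H
for an even number of letters and with K for an odd one. -/
theorem sin_mul_eval_alternating {φ : ℝ} (h : form H.normal K.normal = -Real.cos φ) (k : ℕ) :
    Real.sin φ * H.eval ((alternating K.reflection H.reflection (2 * k)).1 y)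
      = Real.sin ((2 * k + 1) * φ) * H.eval y + Real.sin (2 * k * φ) * K.eval y ∧
    Real.sin φ * H.eval ((alternating K.reflection H.reflection (2 * k + 1)).1 y)
      = Real.sin ((2 * k + 2) * φ) * K.eval y + Real.sin ((2 * k + 1) * φ) * H.eval y := by
  have hsin : ∀ t : ℝ, Real.sin ((t + 2) * φ)
      = 2 * Real.cos φ * Real.sin ((t + 1) * φ) - Real.sin (t * φ) := fun t => by
    rw [show (t + 2) * φ = (t + 1) * φ + φ by ring, show t * φ = (t + 1) * φ - φ by ring,
      Real.sin_add, Real.sin_sub]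
    ring
  induction k generalizing H K with
  | zero =>
    refine ⟨?_, ?_⟩
    · change Real.sin φ * H.eval y = _
      norm_num
    · change Real.sin φ * H.eval (K.reflection.1 y) = _
      rw [Halfspace.eval_reflection, h]
      have := hsin 0
      norm_num at this ⊢
      rw [this]
      ring
  | succ k ih =>
    have h' : form K.normal H.normal = -Real.cos φ := by rwa [form_comm]
    have h1 := ih h
    have h2 := ih h'
    have e : ∀ H K : Halfspace G n, form H.normal K.normal = -Real.cos φ →
        Real.sin φ * H.eval ((alternating K.reflection H.reflection (2 * k)).1 y)
        = Real.sin ((2 * k + 1) * φ) * H.eval y + Real.sin (2 * k * φ) * K.eval y →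
        Real.sin φ * K.eval ((alternating H.reflection K.reflection (2 * k + 1)).1 y)
        = Real.sin ((2 * k + 2) * φ) * H.eval y + Real.sin ((2 * k + 1) * φ) * K.eval y →
        Real.sin φ * H.eval ((alternating K.reflection H.reflection (2 * k + 2)).1 y)
        = Real.sin ((2 * k + 3) * φ) * H.eval y + Real.sin ((2 * k + 2) * φ) * K.eval y := by
      intro H K h h1 h2
      rw [eval_alternating_add_two, h]
      have e1 := hsin (2 * k)
      have e2 := hsin (2 * k + 1)
      rw [show (2 * k + 1 + 2 : ℝ) = 2 * k + 3 by ring,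
        show (2 * k + 1 + 1 : ℝ) = 2 * k + 2 by ring] at e2
      rw [e2]
      linear_combination 2 * Real.cos φ * h2 - h1 - K.eval y * e1
    have a1 := e H K h h1.1 h2.2
    have a2 := e K H h' h2.1 h1.2
    have hc : ((k + 1 : ℕ) : ℝ) = k + 1 := by push_cast; ring
    rw [hc, show 2 * (k + 1) = 2 * k + 2 by ring, show (2 * (k + 1 : ℝ) + 1) = 2 * k + 3 by ring,
      show (2 * (k + 1 : ℝ) + 2) = 2 * k + 4 by ring, show (2 * (k + 1 : ℝ)) = 2 * k + 2 by ring]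
    refine ⟨a1, ?_⟩
    rw [eval_alternating_add_two, h]
    have e1 := hsin (2 * k + 1)
    have e2 := hsin (2 * k + 2)
    rw [show (2 * k + 1 + 2 : ℝ) = 2 * k + 3 by ring,
      show (2 * k + 1 + 1 : ℝ) = 2 * k + 2 by ring] at e1
    rw [show (2 * k + 2 + 2 : ℝ) = 2 * k + 4 by ring,
      show (2 * k + 2 + 1 : ℝ) = 2 * k + 3 by ring] at e2
    rw [e2]
    linear_combination 2 * Real.cos φ * a2 - h1.2 - H.eval y * e1

/-- The functional of a halfspace moved by an alternating word, up to order. -/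
theorem exists_sin_mul_eval_alternating {φ : ℝ} (h : form H.normal K.normal = -Real.cos φ)
    (k : ℕ) : ∃ A B : Halfspace G n, (A = H ∧ B = K ∨ A = K ∧ B = H) ∧ ∀ y,
      Real.sin φ * H.eval ((alternating K.reflection H.reflection k).1 y)
        = Real.sin ((k + 1) * φ) * A.eval y + Real.sin (k * φ) * B.eval y := by
  rcases Nat.even_or_odd' k with ⟨j, rfl | rfl⟩
  · refine ⟨H, K, Or.inl ⟨rfl, rfl⟩, fun y => ?_⟩
    have := (sin_mul_eval_alternating y h j).1
    push_cast
    exact this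
  · refine ⟨K, H, Or.inr ⟨rfl, rfl⟩, fun y => ?_⟩
    have := (sin_mul_eval_alternating y h j).2
    push_cast
    rw [this]
    ring_nf

theorem eval_alternating_pos_of_lt {m k : ℕ} (hm : 2 ≤ m) (hk : k < m)
    (h : form H.normal K.normal = -Real.cos (Real.pi / m)) (hH : 0 < H.eval y)
    (hK : 0 < K.eval y) :
    0 < H.eval ((alternating K.reflection H.reflection k).1 y) := by
  obtain ⟨A, B, hAB, hy⟩ := exists_sin_mul_eval_alternating h k
  have hm0 : (0 : ℝ) < m := by exact_mod_cast (by omega : 0 < m)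
  have hφ0 : 0 < Real.pi / m := div_pos Real.pi_pos hm0
  have hm2 : (2 : ℝ) ≤ m := by exact_mod_cast hm
  have hφ : (m : ℝ) * (Real.pi / m) = Real.pi := by field_simp
  have hk1 : (k + 1 : ℝ) ≤ m := by exact_mod_cast hk
  have hs0 : 0 < Real.sin (Real.pi / m) := Real.sin_pos_of_pos_of_lt_pi hφ0 (by nlinarith)
  have hs1 : 0 ≤ Real.sin ((k + 1) * (Real.pi / m)) :=
    Real.sin_nonneg_of_nonneg_of_le_pi (by positivity) (by nlinarith)
  have hA : 0 < A.eval y ∧ 0 < B.eval y := by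
    rcases hAB with ⟨rfl, rfl⟩ | ⟨rfl, rfl⟩
    · exact ⟨hH, hK⟩
    · exact ⟨hK, hH⟩
  refine pos_of_mul_pos_right ?_ hs0.le
  rw [hy]
  -- One of the two sines may vanish: sin(kφ) at k = 0, and sin((k+1)φ) at k = m - 1.
  rcases Nat.eq_zero_or_pos k with rfl | hk0
  · simpa using mul_pos hs0 hA.1
  · have hk0' : (0 : ℝ) < k := by exact_mod_cast hk0
    have hs2 : 0 < Real.sin (k * (Real.pi / m)) :=
      Real.sin_pos_of_pos_of_lt_pi (by positivity) (by nlinarith)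
    have := mul_nonneg hs1 hA.1.le
    have := mul_pos hs2 hA.2
    linarith

/-- The power moves x only along the span of the two normals and preserves both heights. The Gram
determinant of the normals is sin²(π/m) ≠ 0, so x does not move. -/
theorem reflection_mul_reflection_pow {m : ℕ} (hm : 2 ≤ m)
    (h : form H.normal K.normal = -Real.cos (Real.pi / m)) :
    (H.reflection * K.reflection) ^ m = 1 := by
  have h' : form K.normal H.normal = -Real.cos (Real.pi / m) := by rwa [form_comm]
  have hm0 : (0 : ℝ) < m := by exact_mod_cast (by omega : 0 < m)
  have hm2 : (2 : ℝ) ≤ m := by exact_mod_cast hm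
  set φ := Real.pi / m with hφdef
  have hφ : (m : ℝ) * φ = Real.pi := by rw [hφdef]; field_simp
  have hφ0 : 0 < φ := div_pos Real.pi_pos hm0
  have hs0 : 0 < Real.sin φ := Real.sin_pos_of_pos_of_lt_pi hφ0 (by nlinarith)
  refine Iso.ext fun x => ?_
  have hspan : ∀ k : ℕ, ∃ α β : ℝ, (((H.reflection * K.reflection) ^ k).1 x).1
      = x.1 + α • H.normal + β • K.normal := by
    intro k
    induction k with
    | zero => exact ⟨0, 0, by simp⟩
    | succ k ih =>
      obtain ⟨α, β, hk⟩ := ih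
      rw [pow_succ', mul_apply, mul_apply]
      generalize ((H.reflection * K.reflection) ^ k).1 x = z at hk ⊢
      refine ⟨α - 2 * H.eval (K.reflection.1 z), β - 2 * K.eval z, ?_⟩
      rw [Halfspace.coe_reflection, Halfspace.coe_reflection, hk]
      module
  obtain ⟨α, β, hαβ⟩ := hspan m
  have hH : H.eval (((H.reflection * K.reflection) ^ m).1 x) = H.eval x := by
    obtain ⟨j, rfl⟩ : ∃ j, m = j + 1 := ⟨m - 1, by omega⟩
    have h1 := (sin_mul_eval_alternating x h j).2
    rw [← alternating_two_mul, show 2 * (j + 1) = 2 * j + 1 + 1 by ring, alternating_succ,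
      mul_apply, Halfspace.eval_reflection_self]
    push_cast at hφ
    rw [show (2 * j + 2 : ℝ) * φ = 2 * Real.pi by rw [← hφ]; ring,
      show (2 * j + 1 : ℝ) * φ = 2 * Real.pi - φ by rw [← hφ]; ring, Real.sin_two_pi,
      Real.sin_two_pi_sub] at h1
    apply mul_left_cancel₀ hs0.ne'
    linarith
  have hK : K.eval (((H.reflection * K.reflection) ^ m).1 x) = K.eval x := by
    have h1 := (sin_mul_eval_alternating x h' m).1
    rw [← alternating_two_mul]
    rw [show (2 * m + 1 : ℝ) * φ = φ + 2 * Real.pi by rw [← hφ]; ring,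
      show (2 * m : ℝ) * φ = 2 * Real.pi by rw [← hφ]; ring, Real.sin_two_pi,
      Real.sin_add_two_pi] at h1
    apply mul_left_cancel₀ hs0.ne'
    linarith
  simp only [Halfspace.eval, hαβ, form_add_right, form_smul_right, H.unit, K.unit, h, h'] at hH hK
  have e1 : α = β * Real.cos φ := by linarith
  have e2 : β = α * Real.cos φ := by linarith
  have hsq := Real.sin_sq_add_cos_sq φ
  have hα : α = 0 := by
    have : Real.sin φ ^ 2 * α = 0 := by
      linear_combination e1 + Real.cos φ * e2 + α * hsq
    exact (mul_eq_zero.1 this).resolve_left (pow_ne_zero 2 hs0.ne')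
  rw [hα, zero_mul] at e2
  refine Subtype.ext (hαβ.trans ?_)
  rw [hα, e2]
  simp

end Dihedral

/-! ### The lemma of Tits -/

/-- The walls of `W` meet pairwise at angles `π / m` or not at all. -/
def CoxeterForm (W : Set (Halfspace G n)) : Prop :=
  ∀ H ∈ W, ∀ K ∈ W, H ≠ K → form H.normal K.normal ≤ -1 ∨
    ∃ m : ℕ, 2 ≤ m ∧ form H.normal K.normal = -Real.cos (Real.pi / m)

/-- The open chamber. -/
def chamber (W : Set (Halfspace G n)) : Set (Space G n) := {x | ∀ H ∈ W, 0 < H.eval x}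

variable {W : Set (Halfspace G n)}

theorem mul_self_of_mem : ∀ s ∈ Halfspace.reflection '' W, s * s = 1 := by
  rintro _ ⟨H, -, rfl⟩
  exact H.reflection_mul_self

/-- Induction on the length of w = r_K w'. Among factorizations w = uv with u a word in r_H, r_K and
lengths adding up to at most that of w, take v shortest; by induction v maps the chamber to the
positive sides of H and K. If u starts with r_H, cancelling it shortens w. If u starts with r_K, the
dihedral formulas give positivity, unless u has at least m letters and r_H u can be shortened. -/
theorem eval_pos_or_wordLength_lt (hW : CoxeterForm W) (w : Iso G n)
    (hw : w ∈ reflectionGroupOf W) (H : Halfspace G n) (hH : H ∈ W) :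
    (∀ x ∈ chamber W, 0 < H.eval (w.1 x)) ∨
      wordLength (Halfspace.reflection '' W) (H.reflection * w)
        < wordLength (Halfspace.reflection '' W) w := by
  set S := Halfspace.reflection '' W with hS
  induction hN : wordLength S w using Nat.strong_induction_on generalizing w H with
  | _ N IH =>
  have hwS := mem_pow_wordLength mul_self_of_mem hw
  rw [← hS, hN] at hwS
  cases N with
  | zero =>
    rw [pow_zero, Set.mem_one] at hwS
    subst hwS
    exact Or.inl fun x hx => hx H hH
  | succ N =>
    rw [pow_succ'] at hwS
    obtain ⟨_, ⟨K, hK, rfl⟩, w', hw', rfl⟩ := Set.mem_mul.1 hwS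
    by_cases hHK : H = K
    · subst hHK
      right
      rw [← mul_assoc, H.reflection_mul_self, one_mul]
      exact Nat.lt_succ_of_le (wordLength_le hw')
    set D : Set (Iso G n) := {H.reflection, K.reflection} with hD
    have hDS : D ⊆ S := by
      rintro _ (rfl | rfl)
      · exact ⟨H, hH, rfl⟩
      · exact ⟨K, hK, rfl⟩
    have hex : ∃ j, ∃ k, ∃ u ∈ D ^ k, ∃ v ∈ Subgroup.closure S, K.reflection * w' = u * v ∧
        wordLength S v = j ∧ k + j ≤ N + 1 := by
      refine ⟨_, 1, K.reflection, by rw [pow_one]; exact Or.inr rfl, w',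
        mem_closure_of_mem_pow hw', rfl, rfl, ?_⟩
      have := wordLength_le hw'
      omega
    classical
    have hle : Nat.find hex ≤ N := (Nat.find_min' hex ⟨1, K.reflection,
      by rw [pow_one]; exact Or.inr rfl, w', mem_closure_of_mem_pow hw', rfl, rfl, by
        have := wordLength_le hw'
        omega⟩).trans (wordLength_le hw')
    obtain ⟨k, u, hu, v, hv, huv, hvj, hkj⟩ := Nat.find_spec hex
    have hpos : ∀ L ∈ W, L.reflection ∈ D → ∀ x ∈ chamber W, 0 < L.eval (v.1 x) := by
      intro L hL hLD
      -- If r_L v were shorter than v, moving the letter r_L from v to u would contradict the choice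
      -- of v.
      refine (IH _ (Nat.lt_succ_of_le hle) v hv L hL hvj).resolve_right fun hlt => ?_
      refine Nat.find_min hex hlt ⟨k + 1, u * L.reflection, ?_, L.reflection * v,
        Subgroup.mul_mem _ (Subgroup.subset_closure (hDS hLD)) hv, ?_, rfl, by omega⟩
      · rw [pow_succ]
        exact Set.mul_mem_mul hu hLD
      · rw [huv, mul_assoc, ← mul_assoc L.reflection, L.reflection_mul_self, one_mul]
    have hposH := hpos H hH (Or.inl rfl)
    have hposK := hpos K hK (Or.inr rfl)
    have hsH : H.reflection ∈ S := ⟨H, hH, rfl⟩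
    have hsK : K.reflection ∈ S := ⟨K, hK, rfl⟩
    have hlen : ∀ i, i < k → ∀ r, (r = alternating H.reflection K.reflection i ∨
        r = alternating K.reflection H.reflection i) → wordLength S (r * v) < N + 1 := by
      intro i hi r hr
      have hr' : r ∈ S ^ i := by
        rcases hr with rfl | rfl
        · exact alternating_mem hsH hsK i
        · exact alternating_mem hsK hsH i
      have : wordLength S (r * v) ≤ i + wordLength S v := wordLength_mul_le mul_self_of_mem hr' hv
      omega
    rw [huv]
    obtain ⟨j, hj, rfl | rfl⟩ := exists_alternating_of_mem_pow H.reflection_mul_self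
      K.reflection_mul_self k hu
    · cases j with
      | zero => exact Or.inl hposH
      | succ j =>
        right
        rw [← mul_assoc, mul_alternating_self H.reflection_mul_self]
        exact hlen j (by omega) _ (Or.inr rfl)
    · rcases hW H hH K hK hHK with h | ⟨m, hm, h⟩
      · exact Or.inl fun x hx => eval_alternating_pos_of_le _ h (hposH x hx) (hposK x hx) j
      · rcases lt_or_ge j m with hjm | hjm
        · exact Or.inl fun x hx =>
            eval_alternating_pos_of_lt _ hm hjm h (hposH x hx) (hposK x hx)
        · right
          obtain ⟨i, hi, hi'⟩ := exists_mul_alternating_eq H.reflection_mul_self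
            K.reflection_mul_self (reflection_mul_reflection_pow hm h) hm hjm
          rw [← mul_assoc]
          exact hlen i (by omega) _ hi'

/-- Split the first letter off a shortest word: g = r_H w. By Tits' lemma either w maps the chamber
to the positive side of H, so g maps it to the negative side, or g is shorter than w; both are
absurd. -/
theorem eq_one_of_mem_chamber (hW : CoxeterForm W) {g : Iso G n} (hg : g ∈ reflectionGroupOf W)
    {x : Space G n} (hx : x ∈ chamber W) (hgx : g.1 x ∈ chamber W) : g = 1 := by
  have hgS := mem_pow_wordLength mul_self_of_mem hg
  rcases hN : wordLength (Halfspace.reflection '' W) g with _ | N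
  · rwa [hN, pow_zero, Set.mem_one] at hgS
  · rw [hN, pow_succ'] at hgS
    obtain ⟨_, ⟨H, hH, rfl⟩, w, hw, rfl⟩ := Set.mem_mul.1 hgS
    rcases eval_pos_or_wordLength_lt hW w (mem_closure_of_mem_pow hw) H hH with h | h
    · have h1 := hgx H hH
      rw [mul_apply, H.eval_reflection_self] at h1
      linarith [h x hx]
    · have h1 := wordLength_le hw
      omega

/-! ### The group generated by the reflections in the walls of a Coxeter polytope -/

theorem mem_polytope {x : Space G n} : x ∈ polytope W ↔ ∀ H ∈ W, 0 ≤ H.eval x := by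
  simp only [polytope, Set.mem_iInter, Halfspace.mem_carrier]

theorem isClosed_polytope (W : Set (Halfspace G n)) : IsClosed (polytope W) :=
  isClosed_biInter fun H _ => isClosed_le continuous_const
    ((Halfspace.continuous_form H.normal).comp continuous_subtype_val)

theorem interior_polytope_subset (W : Set (Halfspace G n)) :
    interior (polytope W) ⊆ chamber W := by
  intro x hx H hH
  refine (mem_polytope.1 (interior_subset hx) H hH).lt_of_ne fun h => ?_
  obtain ⟨y, hy, hneg⟩ := H.exists_eval_neg h.symm (mem_interior_iff_mem_nhds.1 hx)
  exact absurd (mem_polytope.1 hy H hH) (not_le.2 hneg)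

theorem IsConvexPolytope.form_lt_one (hW : IsConvexPolytope W) {H K : Halfspace G n} (hH : H ∈ W)
    (hK : K ∈ W) (hne : H ≠ K) : form H.normal K.normal < 1 := by
  by_contra h
  rcases Halfspace.eval_le_or_le (not_lt.1 h) with h1 | h1
  · exact hW.irredundant K hK fun x hx => Halfspace.mem_carrier.2
      ((mem_polytope.1 hx H ⟨hH, hne⟩).trans (h1 x))
  · exact hW.irredundant H hH fun x hx => Halfspace.mem_carrier.2
      ((mem_polytope.1 hx K ⟨hK, hne.symm⟩).trans (h1 x))

theorem IsConvexPolytope.coxeterForm (hW : IsConvexPolytope W) (hA : CoxeterAngles W) :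
    CoxeterForm W := by
  intro H hH K hK hne
  have h1 := hW.form_lt_one hH hK hne
  by_cases h2 : form H.normal K.normal ≤ -1
  · exact Or.inl h2
  push Not at h2
  have hd : ¬ Divergent H K := fun h => by
    have := h.2
    rw [lt_abs] at this
    rcases this with h | h <;> linarith
  rcases hA H hH K hK hne hd with h | ⟨m, hm, h⟩
  · have := Real.arccos_eq_zero.1 h
    linarith
  · have hcos : -form H.normal K.normal = Real.cos (Real.pi / m) := by
      rw [← h, angle, Real.cos_arccos] <;> linarith
    refine Or.inr ⟨m, ?_, by linarith⟩
    -- The angle π, that is m = 1, would mean (e₁,e₂) = 1, which irredundancy excludes.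
    by_contra hm2
    obtain rfl : m = 1 := by omega
    rw [Nat.cast_one, div_one, Real.cos_pi] at hcos
    linarith

/-- Evaluation at x is continuous in the compact-open topology, and the open condition f(x) ∈ gU
singles out g. -/
theorem discreteTopology_of_disjoint {Γ : Subgroup (Iso G n)} {U : Set (Space G n)}
    (hU : IsOpen U) {x : Space G n} (hx : x ∈ U)
    (h : ∀ g ∈ Γ, ∀ y ∈ U, g.1 y ∈ U → g = 1) : DiscreteTopology Γ := by
  rw [discreteTopology_iff_isOpen_singleton]
  rintro ⟨g, hg⟩
  have hi : Continuous fun f : Iso G n => (f.1 : C(Space G n, Space G n)) :=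
    continuous_induced_dom
  have hc : Continuous fun f : Iso G n => f.1 x :=
    (continuous_eval_const (F := C(Space G n, Space G n)) x).comp hi
  have hopen : IsOpen ((fun f : Γ => f.1.1 x) ⁻¹' (g.1 '' U)) :=
    (g.1.isOpenMap U hU).preimage (hc.comp continuous_subtype_val)
  convert hopen using 1
  ext ⟨f, hf⟩
  simp only [Set.mem_singleton_iff, Subtype.mk.injEq, Set.mem_preimage]
  constructor
  · rintro rfl
    exact ⟨x, hx, rfl⟩
  · rintro ⟨y, hy, hyx⟩
    have := h (g⁻¹ * f) (Γ.mul_mem (Γ.inv_mem hg) hf) x hx (by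
      rw [mul_apply, ← hyx, inv_apply_apply]
      exact hy)
    exact (inv_mul_eq_one.1 this).symm

theorem finite_sqDist_le {Γ : Subgroup (Iso G n)} [DiscreteTopology Γ] (hΓ : Γ ≤ fullGroup G n)
    (x y : Space G n) (C : ℝ) : {g ∈ Γ | sqDist (g.1 x) y ≤ C}.Finite := by
  obtain ⟨Q, hQ, hQm⟩ := exists_isCompact_sqDist (isCompact_singleton (x := y)) (max C (sqDist x y))
  refine (finite_of_isCompact hΓ hQ).subset fun g hg => ⟨hg.1, x, ?_, ?_⟩
  · exact hQm y rfl x (le_max_right _ _)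
  · exact hQm y rfl _ (hg.2.trans (le_max_left _ _))

/-- The converse half of the theorem. -/
theorem IsConvexPolytope.isFundamentalDomain (hW : IsConvexPolytope W) (hA : CoxeterAngles W) :
    IsReflectionGroup (reflectionGroupOf W) ∧
      IsFundamentalDomain (reflectionGroupOf W) (polytope W) := by
  have hF := hW.coxeterForm hA
  obtain ⟨x₀, hx₀⟩ := hW.interior_nonempty
  have htriv : ∀ g ∈ reflectionGroupOf W, ∀ y ∈ interior (polytope W),
      g.1 y ∈ interior (polytope W) → g = 1 := fun g hg y hy hgy =>
    eq_one_of_mem_chamber hF hg (interior_polytope_subset W hy) (interior_polytope_subset W hgy)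
  have hd : DiscreteTopology (reflectionGroupOf W) :=
    discreteTopology_of_disjoint isOpen_interior hx₀ htriv
  refine ⟨⟨hd, W, rfl⟩, isClosed_polytope W, fun x => ?_, fun g hg hg1 => ?_⟩
  -- Choose the orbit point nearest to x₀; the bound makes the competition finite. If it lay on the
  -- wrong side of a wall, reflecting it would bring it nearer.
  · obtain ⟨g, hg, hmin⟩ := Set.exists_min_image
      {g ∈ reflectionGroupOf W | sqDist (g.1 x) x₀ ≤ sqDist x x₀} (fun g => sqDist (g.1 x) x₀)
      (finite_sqDist_le (Γ := reflectionGroupOf W)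
        (closure_reflection_le W) x x₀ _) ⟨1, Subgroup.one_mem _, le_rfl⟩
    refine ⟨g, hg.1, mem_polytope.2 fun H hH => ?_⟩
    by_contra hneg
    push Not at hneg
    have hlt : sqDist ((H.reflection * g).1 x) x₀ < sqDist (g.1 x) x₀ := by
      rw [mul_apply, sqDist_reflection_left]
      nlinarith [interior_polytope_subset W hx₀ H hH]
    exact absurd (hmin _ ⟨Subgroup.mul_mem _ (Subgroup.subset_closure ⟨H, hH, rfl⟩) hg.1,
      hlt.le.trans hg.2⟩) (not_le.2 hlt)
  · rw [Set.disjoint_left]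
    rintro _ ⟨y, hy, rfl⟩ hgy
    exact hg1 (htriv g hg y hy hgy)

/-! ### The chambers of a discrete reflection group -/

theorem nonempty_space : Nonempty (Space G n) := by
  cases G
  · exact ⟨⟨0, trivial⟩⟩
  · exact ⟨⟨EuclideanSpace.single 0 1, by simp [points]⟩⟩
  · exact ⟨⟨EuclideanSpace.single 0 1, by simp [points, lorentz]⟩⟩

/-- The halfspaces whose reflections belong to `Γ`. -/
def mirrors (Γ : Subgroup (Iso G n)) : Set (Halfspace G n) := {H | H.reflection ∈ Γ}

/-- The halfspaces bounded by mirrors of `Γ` that contain the point `x` in their interior. -/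
def mirrorsAt (Γ : Subgroup (Iso G n)) (x : Space G n) : Set (Halfspace G n) :=
  {H ∈ mirrors Γ | 0 < H.eval x}

/-- The halfspaces containing `x` whose mirror is the only one that separates `x` from its
reflection. -/
def walls (Γ : Subgroup (Iso G n)) (x : Space G n) : Set (Halfspace G n) :=
  {H ∈ mirrorsAt Γ x | ∀ K ∈ mirrorsAt Γ x, K ≠ H → 0 < K.eval (H.reflection.1 x)}

/-- No mirror of `Γ` passes through `x`. -/
def IsGeneric (Γ : Subgroup (Iso G n)) (x : Space G n) : Prop := ∀ H ∈ mirrors Γ, H.eval x ≠ 0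

variable {Γ : Subgroup (Iso G n)} {x : Space G n}

theorem opposite_mem_mirrors {H : Halfspace G n} (hH : H ∈ mirrors Γ) :
    H.opposite ∈ mirrors Γ := by
  change H.opposite.reflection ∈ Γ
  rw [H.reflection_opposite]
  exact hH

theorem image_mem_mirrors {H K : Halfspace G n} (hH : H ∈ mirrors Γ) (hK : K ∈ mirrors Γ) :
    K.image H ∈ mirrors Γ := by
  change (K.image H).reflection ∈ Γ
  rw [K.reflection_image]
  exact Γ.mul_mem (Γ.mul_mem hK hH) hK

theorem IsGeneric.mem_or_opposite_mem (hx : IsGeneric Γ x) {H : Halfspace G n}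
    (hH : H ∈ mirrors Γ) : H ∈ mirrorsAt Γ x ∨ H.opposite ∈ mirrorsAt Γ x := by
  rcases lt_or_gt_of_ne (hx H hH) with h | h
  · exact Or.inr ⟨opposite_mem_mirrors hH, by rw [Halfspace.eval_opposite]; linarith⟩
  · exact Or.inl ⟨hH, h⟩

/-- Conjugates of reflections in Γ lie in Γ, so moving a mirror by a dihedral word gives a mirror.
-/
theorem exists_eval_alternating {A B : Halfspace G n} (hA : A ∈ mirrors Γ) (hB : B ∈ mirrors Γ)
    (k : ℕ) {H : Halfspace G n} (hH : H ∈ mirrors Γ) : ∃ L ∈ mirrors Γ, ∀ y,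
      L.eval y = H.eval ((alternating A.reflection B.reflection k).1 y) := by
  induction k generalizing A B H with
  | zero => exact ⟨H, hH, fun y => rfl⟩
  | succ k ih =>
    obtain ⟨L, hL, hLy⟩ := ih hB hA (image_mem_mirrors hH hA)
    exact ⟨L, hL, fun y => by rw [hLy, Halfspace.eval_image, alternating_succ, mul_apply]⟩

/-- The displacement x - r_H x is twice the height times the unit normal; positivity of the height
then determines both. -/
theorem Halfspace.eq_of_reflection_apply_eq {H K : Halfspace G n} (hH0 : 0 < H.eval x)
    (hK0 : 0 < K.eval x) (h : H.reflection.1 x = K.reflection.1 x) : H = K := by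
  have hv : (2 * H.eval x) • H.normal = (2 * K.eval x) • K.normal := by
    have : (H.reflection.1 x).1 = (K.reflection.1 x).1 := by rw [h]
    rwa [Halfspace.coe_reflection, Halfspace.coe_reflection, sub_right_inj] at this
  have hs : (2 * H.eval x) ^ 2 = (2 * K.eval x) ^ 2 := by
    have h1 : form ((2 * H.eval x) • H.normal) ((2 * H.eval x) • H.normal)
        = form ((2 * K.eval x) • K.normal) ((2 * K.eval x) • K.normal) := by rw [hv]
    simp only [form_smul_left, form_smul_right, H.unit, K.unit] at h1
    linarith
  have he : H.eval x = K.eval x := by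
    rw [sq_eq_sq₀ (by linarith) (by linarith)] at hs
    linarith
  rw [he] at hv
  have hn : H.normal = K.normal := smul_right_injective _ (by linarith : (2 * K.eval x) ≠ 0) hv
  simp only [Halfspace.eval, hn, sub_right_inj] at he
  cases H
  cases K
  simp_all

theorem reflection_injOn (Γ : Subgroup (Iso G n)) (x : Space G n) :
    Set.InjOn Halfspace.reflection (mirrorsAt Γ x) := fun _ hH _ hK h =>
  Halfspace.eq_of_reflection_apply_eq hH.2 hK.2 (by rw [h])

theorem finite_mirrorsAt [DiscreteTopology Γ] (hΓ : Γ ≤ fullGroup G n)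
    (x : Space G n) {K : Set (Space G n)} (hK : IsCompact K) :
    {H ∈ mirrorsAt Γ x | ∃ y ∈ K, H.reflection.1 y ∈ K}.Finite := by
  refine Set.Finite.of_finite_image ((finite_of_isCompact hΓ hK).subset ?_)
    ((reflection_injOn Γ x).mono fun H h => h.1)
  rintro _ ⟨H, hH, rfl⟩
  exact ⟨hH.1.1, hH.2⟩

theorem finite_mirrorsAt_eval_le [DiscreteTopology Γ] (hΓ : Γ ≤ fullGroup G n)
    (x : Space G n) (C : ℝ) :
    {H ∈ mirrorsAt Γ x | H.eval x ≤ C}.Finite := by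
  refine Set.Finite.of_finite_image ((finite_sqDist_le hΓ x x (4 * C ^ 2)).subset ?_)
    ((reflection_injOn Γ x).mono fun H h => h.1)
  rintro _ ⟨H, hH, rfl⟩
  refine ⟨hH.1.1, ?_⟩
  rw [sqDist_reflection_left, sqDist_self]
  nlinarith [hH.1.2, hH.2]

/-- Hyperplanes are closed with empty interior, so they can be removed from U one at a time. -/
theorem exists_forall_apply_ne {F : Set (Iso G n)} (hF : F.Finite)
    (hr : F ⊆ Set.range Halfspace.reflection) {U : Set (Space G n)} (hU : IsOpen U)
    (hne : U.Nonempty) : ∃ x ∈ U, ∀ g ∈ F, g.1 x ≠ x := by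
  induction F, hF using Set.Finite.induction_on generalizing U with
  | empty => exact ⟨hne.some, hne.some_mem, fun g hg => hg.elim⟩
  | @insert g F _ _ ih =>
    obtain ⟨H, rfl⟩ := hr (Set.mem_insert g F)
    have hne' : (U ∩ {x | H.eval x ≠ 0}).Nonempty := by
      obtain ⟨u, hu⟩ := hne
      by_cases h : H.eval u = 0
      · obtain ⟨y, hy, hneg⟩ := H.exists_eval_neg h (hU.mem_nhds hu)
        exact ⟨y, hy, hneg.ne⟩
      · exact ⟨u, hu, h⟩
    obtain ⟨x, hx, hxF⟩ := ih ((Set.subset_insert _ _).trans hr)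
      (hU.inter (isOpen_ne_fun H.continuous_eval continuous_const)) hne'
    refine ⟨x, hx.1, ?_⟩
    rintro g (rfl | hg)
    · exact fun h => hx.2 (Halfspace.reflection_eq_self_iff.1 h)
    · exact hxF g hg

theorem exists_isGeneric [DiscreteTopology Γ] (hΓ : Γ ≤ fullGroup G n) :
    ∃ x, IsGeneric Γ x := by
  obtain ⟨p⟩ := nonempty_space (G := G) (n := n)
  obtain ⟨Q, hQ, hQm⟩ := exists_isCompact_sqDist (isCompact_singleton (x := p)) 1
  obtain ⟨x, hx, hxF⟩ := exists_forall_apply_ne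
    (F := {g ∈ Γ | ∃ x ∈ Q, g.1 x ∈ Q} ∩ Set.range Halfspace.reflection)
    ((finite_of_isCompact hΓ hQ).subset Set.inter_subset_left) Set.inter_subset_right
    (isOpen_lt (continuous_sqDist continuous_id continuous_const) continuous_const)
    ⟨p, show sqDist p p < 1 by rw [sqDist_self]; exact one_pos⟩
  refine ⟨x, fun H hH h0 => ?_⟩
  have hxQ : x ∈ Q := hQm p rfl x (le_of_lt hx)
  have hfix := Halfspace.reflection_eq_self_iff.2 h0
  exact hxF H.reflection ⟨⟨hH, x, hxQ, by rwa [hfix]⟩, H, rfl⟩ hfix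

theorem polytope_mirrorsAt_mem_nhds [DiscreteTopology Γ] (hΓ : Γ ≤ fullGroup G n)
    (x : Space G n) : polytope (mirrorsAt Γ x) ∈ nhds x := by
  obtain ⟨Q, hQ, hQm⟩ := exists_isCompact_sqDist (isCompact_singleton (x := x)) 1
  have h1 : ∀ᶠ y in nhds x, ∀ H ∈ {H ∈ mirrorsAt Γ x | ∃ y ∈ Q, H.reflection.1 y ∈ Q},
      0 < H.eval y := (Filter.eventually_all_finite (finite_mirrorsAt hΓ x hQ)).2 fun H hH =>
    H.continuous_eval.continuousAt.eventually_const_lt hH.1.2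
  have h2 : ∀ᶠ y in nhds x, sqDist y x < 1 :=
    (continuous_sqDist continuous_id continuous_const).continuousAt.eventually_lt_const
      (by simp [sqDist_self])
  filter_upwards [h1, h2] with y hy1 hy2
  refine mem_polytope.2 fun H hH => ?_
  by_contra hneg
  push Not at hneg
  -- If H separates y from x, then r_H y is still nearer to x than y, so H is among the finitely
  -- many mirrors already handled.
  refine absurd (hy1 H ⟨hH, y, hQm x rfl y hy2.le, hQm x rfl _ ?_⟩) (not_lt.2 hneg.le)
  rw [sqDist_reflection_left]
  nlinarith [hH.2]

theorem isConvexPolytope_walls [DiscreteTopology Γ] (hΓ : Γ ≤ fullGroup G n)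
    (x : Space G n) : IsConvexPolytope (walls Γ x) where
  locallyFinite K hK := by
    refine (finite_mirrorsAt hΓ x hK).subset ?_
    rintro H ⟨hH, y, hy, hyK⟩
    refine ⟨hH.1, y, hyK, ?_⟩
    rwa [Halfspace.reflection_eq_self_iff.2 (Halfspace.mem_hyperplane.1 hy)]
  interior_nonempty := by
    refine ⟨x, mem_interior_iff_mem_nhds.2 ?_⟩
    filter_upwards [polytope_mirrorsAt_mem_nhds hΓ x] with y hy
    exact mem_polytope.2 fun H hH => mem_polytope.1 hy H hH.1
  irredundant H hH hsub := by
    -- The witness of irredundancy is r_H x: by the choice of walls, it violates H alone.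
    have h1 : H.reflection.1 x ∈ H.carrier :=
      hsub (mem_polytope.2 fun K hK => (hH.2 K hK.1.1 hK.2).le)
    rw [Halfspace.mem_carrier, H.eval_reflection_self] at h1
    linarith [hH.1.2]

/-- Every mirror is that of a product of reflections in walls. -/
theorem IsGeneric.reflection_mem [DiscreteTopology Γ] (hx : IsGeneric Γ x)
    (hΓ : Γ ≤ fullGroup G n) {H₀ : Halfspace G n} (hH₀ : H₀ ∈ mirrorsAt Γ x) :
    H₀.reflection ∈ reflectionGroupOf (walls Γ x) := by
  by_contra hbad₀
  obtain ⟨H, ⟨⟨hH, hle⟩, hbad⟩, hmin⟩ := Set.exists_min_image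
    ({K ∈ mirrorsAt Γ x | K.eval x ≤ H₀.eval x} ∩
      {K | K.reflection ∉ reflectionGroupOf (walls Γ x)}) (fun K => K.eval x)
    ((finite_mirrorsAt_eval_le hΓ x _).subset Set.inter_subset_left) ⟨H₀, ⟨hH₀, le_rfl⟩, hbad₀⟩
  have hgood : ∀ K ∈ mirrorsAt Γ x, K.eval x < H.eval x →
      K.reflection ∈ reflectionGroupOf (walls Γ x) := by
    intro K hK hlt
    by_contra hKb
    exact absurd (hmin K ⟨⟨hK, hlt.le.trans hle⟩, hKb⟩) (not_le.2 hlt)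
  have hh := hH.2
  -- Put c = (e_H, e_K). The hypotheses yield K(x) < H(x) and 0 < cK(x) < H(x), so the mirrors of K
  -- and of r_K H both have height below H(x). By minimality of H their reflections are generated by
  -- walls, hence so is r_H, a conjugate.
  have step : ∀ K ∈ mirrorsAt Γ x, K.eval x ≤ form H.normal K.normal * H.eval x →
      0 < H.eval x ^ 2 + K.eval x ^ 2 - 2 * form H.normal K.normal * H.eval x * K.eval x →
      False := by
    intro K hK hle hpos
    have hk := hK.2
    have h1 : form H.normal K.normal * K.eval x < H.eval x := by
      by_contra hcon
      nlinarith
    have h2 : K.eval x < H.eval x := by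
      by_contra hcon
      nlinarith
    have hKg := hgood K hK h2
    have h3 : 0 < form H.normal K.normal * K.eval x := by
      have : 0 < form H.normal K.normal := by
        by_contra hcon
        nlinarith
      positivity
    have hL : (K.image H).reflection ∈ reflectionGroupOf (walls Γ x) := by
      rcases hx.mem_or_opposite_mem (image_mem_mirrors hH.1 hK.1) with hL | hL
      · refine hgood _ hL ?_
        rw [Halfspace.eval_image, Halfspace.eval_reflection]
        linarith
      · rw [← Halfspace.reflection_opposite]
        refine hgood _ hL ?_
        rw [Halfspace.eval_opposite, Halfspace.eval_image, Halfspace.eval_reflection]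
        linarith
    refine hbad ?_
    have := Subgroup.mul_mem _ (Subgroup.mul_mem _ hKg hL) hKg
    rw [Halfspace.reflection_image] at this
    rwa [mul_assoc, mul_assoc (K.reflection * H.reflection), K.reflection_mul_self, mul_one,
      ← mul_assoc, K.reflection_mul_self, one_mul] at this
  have hHW : H ∉ walls Γ x := fun h => hbad (Subgroup.subset_closure ⟨H, h, rfl⟩)
  obtain ⟨K, hK, hKH, hneg⟩ : ∃ K ∈ mirrorsAt Γ x, K ≠ H ∧ K.eval (H.reflection.1 x) ≤ 0 := by
    by_contra hcon
    push Not at hcon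
    exact hHW ⟨hH, hcon⟩
  have hne : K.eval (H.reflection.1 x) ≠ 0 := by
    rw [← Halfspace.eval_image]
    exact hx _ (image_mem_mirrors hK.1 hH.1)
  have hlt := hneg.lt_of_ne hne
  have hpos : 0 < H.eval x ^ 2 + K.eval x ^ 2
      - 2 * form H.normal K.normal * H.eval x * K.eval x := by
    have h1 := sqDist_reflection_reflection H K x
    have h2 := (sqDist_nonneg (H.reflection.1 x) (K.reflection.1 x)).lt_of_ne fun h =>
      hKH (Halfspace.eq_of_reflection_apply_eq hh hK.2 (eq_of_sqDist_eq_zero h.symm)).symm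
    linarith
  rw [Halfspace.eval_reflection, form_comm] at hlt
  rcases le_total (K.eval x) (form H.normal K.normal * H.eval x) with h | h
  · exact step K hK h hpos
  -- Otherwise replace K by the opposite of its image under r_H: c and the quadratic expression are
  -- unchanged, while the height becomes 2cH(x) - K(x), positive and at most cH(x).
  · have hf : form H.normal (H.image K).opposite.normal = form H.normal K.normal := by
      simp only [Halfspace.opposite, Halfspace.image, form_neg_right, form_sub_right,
        form_smul_right, H.unit, form_comm K.normal]
      ring
    have he : (H.image K).opposite.eval x
        = 2 * form H.normal K.normal * H.eval x - K.eval x := by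
      rw [Halfspace.eval_opposite, Halfspace.eval_image, Halfspace.eval_reflection,
        form_comm K.normal]
      ring
    refine step (H.image K).opposite
      ⟨opposite_mem_mirrors (image_mem_mirrors hK.1 hH.1), by rw [he]; linarith⟩ ?_ ?_
    · rw [hf, he]
      linarith
    · rw [hf, he]
      linarith

/-- At r_B x the right side is negative, whereas B is a wall, so every L ≠ B is positive there. For
L = B, evaluation at x forces s < q and evaluation at r_B x forces s > q. -/
theorem not_eval_eq_sub {A B L : Halfspace G n} (hA : A ∈ walls Γ x) (hB : B ∈ walls Γ x)
    (hAB : A ≠ B) (hL : L ∈ mirrorsAt Γ x) {p q s : ℝ} (hp : 0 < p) (hq : 0 < q) (hs : 0 < s)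
    (h : ∀ y, s * L.eval y = q * B.eval y - p * A.eval y) : False := by
  have h1 := h x
  have h2 := h (B.reflection.1 x)
  have hA1 := mul_pos hp (hB.2 A hA.1 hAB)
  have hA2 := mul_pos hp hA.1.2
  have hB1 := mul_pos hq hB.1.2
  rw [B.eval_reflection_self] at h2
  by_cases hLB : L = B
  · subst hLB
    rw [L.eval_reflection_self] at h2
    linarith
  · have := mul_pos hs (hB.2 L hL hLB)
    linarith

theorem IsGeneric.coxeterAngles (hx : IsGeneric Γ x) : CoxeterAngles (walls Γ x) := by
  intro H hH K hK hne _
  by_contra hcon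
  push Not at hcon
  obtain ⟨h0, hm⟩ := hcon
  set φ := angle H K with hφ
  have hφ0 : 0 < φ := (Real.arccos_nonneg _).lt_of_ne h0.symm
  have hφπ : φ < Real.pi := (Real.arccos_le_pi _).lt_of_ne fun h =>
    hm 1 one_pos (by rw [Nat.cast_one, div_one]; exact h)
  have h1 : -form H.normal K.normal < 1 := by
    by_contra h
    exact h0 (Real.arccos_eq_zero.2 (not_lt.1 h))
  have h2 : -1 < -form H.normal K.normal := by
    by_contra h
    exact hφπ.ne (Real.arccos_eq_pi.2 (not_lt.1 h))
  have hform : form H.normal K.normal = -Real.cos φ := by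
    rw [hφ, angle, Real.cos_arccos h2.le h1.le, neg_neg]
  -- With kφ < π < (k+1)φ, the word with k letters produces a mirror whose functional has
  -- coefficients sin((k+1)φ) < 0 and sin(kφ) > 0 in the two walls.
  set k := ⌊Real.pi / φ⌋₊ with hk
  have hk0 : 0 < k := Nat.floor_pos.2 ((one_le_div hφ0).2 hφπ.le)
  have hk0' : (0 : ℝ) < k := by exact_mod_cast hk0
  have hk1 : k * φ < Real.pi := by
    have := Nat.floor_le (div_pos Real.pi_pos hφ0).le
    rw [← hk, le_div_iff₀ hφ0] at this
    refine this.lt_of_ne fun h => hm k hk0 ?_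
    rw [← h]
    field_simp
  have hk2 : Real.pi < (k + 1) * φ := by
    have := Nat.lt_floor_add_one (Real.pi / φ)
    rwa [← hk, div_lt_iff₀ hφ0] at this
  have hs : 0 < Real.sin φ := Real.sin_pos_of_pos_of_lt_pi hφ0 hφπ
  have hs1 : 0 < Real.sin (k * φ) := Real.sin_pos_of_pos_of_lt_pi (by positivity) hk1
  have hs2 : 0 < -Real.sin ((k + 1) * φ) := by
    rw [← Real.sin_sub_pi]
    exact Real.sin_pos_of_pos_of_lt_pi (by linarith) (by linarith)
  obtain ⟨A, B, hAB, hy⟩ := exists_sin_mul_eval_alternating hform k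
  obtain ⟨L, hL, hLy⟩ := exists_eval_alternating hK.1.1 hH.1.1 k hH.1.1
  obtain ⟨hA, hB, hAB⟩ : A ∈ walls Γ x ∧ B ∈ walls Γ x ∧ A ≠ B := by
    rcases hAB with ⟨rfl, rfl⟩ | ⟨rfl, rfl⟩
    · exact ⟨hH, hK, hne⟩
    · exact ⟨hK, hH, hne.symm⟩
  rcases hx.mem_or_opposite_mem hL with h | h
  · exact not_eval_eq_sub hA hB hAB h hs2 hs1 hs fun y => by rw [hLy, hy]; ring
  · exact not_eval_eq_sub hB hA hAB.symm h hs1 hs2 hs fun y => by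
      rw [Halfspace.eval_opposite, mul_neg, hLy, hy]; ring

end ReflectionGroups

end

/-! ### Assembling both halves -/

theorem mainTheorem5 (G : ReflectionGroups.Geometry) (n : ℕ) :
    (∀ Γ : Subgroup (ReflectionGroups.Iso G n), ReflectionGroups.IsReflectionGroup Γ →
      ∃ W : Set (ReflectionGroups.Halfspace G n),
        ReflectionGroups.IsConvexPolytope W ∧
        ReflectionGroups.IsFundamentalDomain Γ (ReflectionGroups.polytope W) ∧
        ReflectionGroups.CoxeterAngles W ∧
        Γ = ReflectionGroups.reflectionGroupOf W) ∧
    (∀ W : Set (ReflectionGroups.Halfspace G n),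
      ReflectionGroups.IsConvexPolytope W → ReflectionGroups.CoxeterAngles W →
        ReflectionGroups.IsReflectionGroup (ReflectionGroups.reflectionGroupOf W) ∧
        ReflectionGroups.IsFundamentalDomain (ReflectionGroups.reflectionGroupOf W)
          (ReflectionGroups.polytope W)) := by
  refine ⟨?_, fun W hW hA => hW.isFundamentalDomain hA⟩
  rintro Γ ⟨hd, S, hS⟩
  have hΓ : Γ ≤ ReflectionGroups.fullGroup G n := hS ▸ ReflectionGroups.closure_reflection_le S
  obtain ⟨x, hx⟩ := ReflectionGroups.exists_isGeneric hΓ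
  have hW := ReflectionGroups.isConvexPolytope_walls hΓ x
  have hA := hx.coxeterAngles
  have heq : Γ = ReflectionGroups.reflectionGroupOf (ReflectionGroups.walls Γ x) := by
    refine le_antisymm ?_ ((Subgroup.closure_le _).2 ?_)
    · conv_lhs => rw [hS]
      rw [Subgroup.closure_le]
      rintro _ ⟨H, hH, rfl⟩
      have hHm : H ∈ ReflectionGroups.mirrors Γ := by
        change _ ∈ Γ
        rw [hS]
        exact Subgroup.subset_closure ⟨H, hH, rfl⟩
      -- A given generator may have x on its negative side; the opposite halfspace has the same
      -- reflection.
      rcases hx.mem_or_opposite_mem hHm with h | h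
      · exact hx.reflection_mem hΓ h
      · rw [← H.reflection_opposite]
        exact hx.reflection_mem hΓ h
    · rintro _ ⟨H, hH, rfl⟩
      exact hH.1.1
  refine ⟨_, hW, ?_, hA, heq⟩
  have := (hW.isFundamentalDomain hA).2
  rwa [← heq] at this
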